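/- Let $F$ be one of $\mathbb{R},\mathbb{C},\mathbb{H}$ and $m=\dim_{\mathbb{R}}F\in\{1,2,4\}$. Let $E(4,F)$ be the $(6m+3)$-dimensional real vector space of traceless Hermitian $4\times4$ matrices over $F$ with inner product $\langle A,B\rangle=\operatorname{Re}\operatorname{tr}(AB^*)$, and let $S(4,F)$ be its unit sphere. Let $f\colon S(4,F)\to\mathbb{R}$, $f(A)=\operatorname{tr}A^3$. Let $\mathcal{B}_{4,F}$ be the set of $A\in S(4,F)$ with $f(A)=0$ at which $f$ is regular (that is, $df_A\ne0$), and let $\widetilde{\mathcal{B}}_{4,F}$ be the set of invertible matrices in $\mathcal{B}_{4,F}$. Then $\widetilde{\mathcal{B}}_{4,F}$ is an open subset of $\mathcal{B}_{4,F}$, and it is a $(6m+1)$-dimensional smooth embedded hypersurface of $S(4,F)$ that is orientable, connected, noncompact and austere (with respect to every normal vector the principal curvatures, counted with multiplicity, are invariant under multiplication by $-1$). With $\rho(A)=|\operatorname{grad}^{S}f(A)|$, the field $\xi=\rho^{-1}\operatorname{grad}^{S}f$ is a smooth unit normal field along $\widetilde{\mathcal{B}}_{4,F}$ in $S(4,F)$,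 and $\widetilde{\mathcal{B}}_{4,F}$, oriented by $\xi$, is proper Dupin: along each curvature surface (a connected submanifold whose tangent spaces are the principal spaces of a principal curvature) the corresponding principal curvature is constant, and the number of distinct principal curvatures is constant. Moreover, every $A\in\widetilde{\mathcal{B}}_{4,F}$ can be written as $A=P^*\operatorname{diag}(\lambda_1,-\lambda_1,\lambda_2,-\lambda_2)P$ with $P\in M(4,F)$, $P^*P=PP^*=I$, and real numbers $\lambda_1>\lambda_2>0$; one has $\rho(A)>0$; and, with respect to $\xi$, the principal curvatures at $A$ are exactly the five distinct numbers $$\frac{3(\lambda_1+\lambda_2)}{\rho(A)},\quad -\frac{3(\lambda_1+\lambda_2)}{\rho(A)},\quad \frac{3(\lambda_1-\lambda_2)}{\rho(A)},\quad -\frac{3(\lambda_1-\lambda_2)}{\rho(A)},\quad 0,$$ with multiplicities $m,\ m,\ m,\ m,\ 2m+1$ respectively. -/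

import Mathlib

open scoped ContDiff Topology

noncomputable section

/-! ### Submanifolds of a Euclidean space and hypersurfaces of its unit sphere -/

section Submanifold

variable {V : Type} [NormedAddCommGroup V] [InnerProductSpace ℝ V]

/-- A homeomorphism `φ` from an open subset of `ℝ^d` onto a relatively open subset of `M ⊆ V` is
a smooth local parametrization of `M` if it is a smooth immersion into `V`. -/
structure IsLocalParametrization {d : ℕ} {M : Set V}
    (φ : OpenPartialHomeomorph (EuclideanSpace ℝ (Fin d)) M) : Prop where
  contDiffOn : ContDiffOn ℝ ∞ (fun u => (φ u : V)) φ.source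
  injective_fderiv : ∀ u ∈ φ.source, Function.Injective (fderiv ℝ (fun u => (φ u : V)) u)

/-- `M` is a `d`-dimensional smooth embedded submanifold of `V`. -/
def IsEmbeddedSubmanifold (d : ℕ) (M : Set V) : Prop :=
  ∀ x : M, ∃ φ : OpenPartialHomeomorph (EuclideanSpace ℝ (Fin d)) M,
    IsLocalParametrization φ ∧ x ∈ φ.target

/-- `M` admits an atlas of smooth local parametrizations all of whose transition maps have
positive Jacobian determinant. -/
def IsOrientableSubmanifold (d : ℕ) (M : Set V) : Prop :=
  ∃ 𝒜 : Set (OpenPartialHomeomorph (EuclideanSpace ℝ (Fin d)) M),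
    (∀ φ ∈ 𝒜, IsLocalParametrization φ) ∧
    (∀ x : M, ∃ φ ∈ 𝒜, x ∈ φ.target) ∧
    (∀ φ ∈ 𝒜, ∀ ψ ∈ 𝒜, ∀ u ∈ (φ.trans ψ.symm).source,
      0 < (fderiv ℝ (φ.trans ψ.symm) u).det)

/-- `M` is a `d`-dimensional smooth embedded hypersurface of the unit sphere of `V`. -/
def IsSphereHypersurface (d : ℕ) (M : Set V) : Prop :=
  Module.finrank ℝ V = d + 2 ∧ M ⊆ Metric.sphere (0 : V) 1 ∧ IsEmbeddedSubmanifold d M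

/-- The tangent space of `M` at `x`, as a subspace of `V`: it is generated by the velocities of
the smooth curves in `M` through `x`. -/
def tangentSpaceOf (M : Set V) (x : V) : Submodule ℝ V :=
  Submodule.span ℝ {v | ∃ γ : ℝ → V, ContDiffAt ℝ ∞ γ 0 ∧ γ 0 = x ∧
    (∀ᶠ t in 𝓝 (0 : ℝ), γ t ∈ M) ∧ HasDerivAt γ v 0}

/-- `ξ` is a smooth normal field along the submanifold `M` of the unit sphere: `ξ x` is
tangent to the sphere (that is, orthogonal to `x`) and orthogonal to `M`. -/
structure IsNormalField (M : Set V) (ξ : V → V) : Prop where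
  contDiffOn : ContDiffOn ℝ ∞ ξ M
  tangent_sphere : ∀ x ∈ M, inner ℝ x (ξ x) = 0
  normal : ∀ x ∈ M, ξ x ∈ (tangentSpaceOf M x)ᗮ

/-- A smooth unit normal field. -/
def IsUnitNormalField (M : Set V) (ξ : V → V) : Prop :=
  IsNormalField M ξ ∧ ∀ x ∈ M, ‖ξ x‖ = 1

variable [FiniteDimensional ℝ V]

/-- The shape operator `v ↦ -(D_v ξ)ᵀ` of the tangent space of `M` at `x`, for a normal field
`ξ` along `M`; here `ᵀ` is the orthogonal projection onto the tangent space of `M` at `x`.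
(On tangent vectors the derivative within `M` is the usual derivative along `M`.) -/
def shapeOperator (M : Set V) (ξ : V → V) (x : V) :
    Module.End ℝ (tangentSpaceOf M x) :=
  -((((tangentSpaceOf M x).orthogonalProjectionOnto).comp
      ((fderivWithin ℝ ξ M x).comp (tangentSpaceOf M x).subtypeL)) :
      tangentSpaceOf M x →L[ℝ] tangentSpaceOf M x).toLinearMap

/-- The principal curvatures of `M` at `x` with respect to `ξ`, counted with multiplicity. -/
def principalCurvatures (M : Set V) (ξ : V → V) (x : V) : Multiset ℝ :=
  (shapeOperator M ξ x).charpoly.roots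

/-- The submanifold `M` of the unit sphere is austere: for every normal vector (extended to a
smooth normal field near the point) the principal curvatures, counted with multiplicity, are of
the form `λ₁, -λ₁, …, λₚ, -λₚ, 0, …, 0`, i.e. invariant under multiplication by `-1`. -/
def IsAustere (M : Set V) : Prop :=
  ∀ (W : Set V) (ξ : V → V), IsOpen W → IsNormalField (M ∩ W) ξ → ∀ x ∈ M ∩ W,
    (principalCurvatures (M ∩ W) ξ x).map (fun κ => -κ) = principalCurvatures (M ∩ W) ξ x

/-- `S` is a curvature surface of the hypersurface `M` oriented by `ξ`, with corresponding
principal curvature `κ` (a function on `S`): a connected submanifold whose tangent space at each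
`x` is the principal space of the principal curvature `κ x`. -/
structure IsCurvatureSurface (M : Set V) (ξ : V → V) (S : Set V) (κ : V → ℝ) : Prop where
  subset : S ⊆ M
  connected : IsConnected S
  submanifold : ∃ k : ℕ, IsEmbeddedSubmanifold k S
  hasEigenvalue : ∀ x ∈ S, (shapeOperator M ξ x).HasEigenvalue (κ x)
  tangent_eq : ∀ x ∈ S, tangentSpaceOf S x =
    ((shapeOperator M ξ x).eigenspace (κ x)).map (tangentSpaceOf M x).subtype

/-- The hypersurface `M`, oriented by `ξ`, is Dupin: along each curvature surface the
corresponding principal curvature is constant. -/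
def IsDupin (M : Set V) (ξ : V → V) : Prop :=
  ∀ (S : Set V) (κ : V → ℝ), IsCurvatureSurface M ξ S κ → ∀ x ∈ S, ∀ y ∈ S, κ x = κ y

/-- The hypersurface `M`, oriented by `ξ`, is proper Dupin: it is Dupin, and the number of
distinct principal curvatures is constant on `M`. -/
def IsProperDupin (M : Set V) (ξ : V → V) : Prop :=
  IsDupin M ξ ∧ ∃ g : ℕ, ∀ x ∈ M, {κ : ℝ | (shapeOperator M ξ x).HasEigenvalue κ}.ncard = g

/-- The gradient on the unit sphere, at the point `x` of it, of the restriction of `f` to the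
sphere: the projection of the Euclidean gradient to the tangent space `x^⊥` of the sphere. -/
def sphereGrad [CompleteSpace V] (f : V → ℝ) (x : V) : V :=
  (ℝ ∙ x)ᗮ.starProjection (gradient f x)

end Submanifold

/-! ### Traceless Hermitian matrices over `ℝ`, `ℂ`, `ℍ` -/

/-- `F` is one of `ℝ`, `ℂ`, `ℍ`, with its standard norm, conjugation and inner product. -/
inductive IsRealComplexOrQuaternion :
    (F : Type) → [NormedRing F] → [StarRing F] → [InnerProductSpace ℝ F] → Prop
  | real : IsRealComplexOrQuaternion ℝ
  | complex : IsRealComplexOrQuaternion ℂ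
  | quaternion : IsRealComplexOrQuaternion (Quaternion ℝ)

instance instStarModuleQuaternion : StarModule ℝ (Quaternion ℝ) where
  star_smul r a := by simp [Quaternion.star_smul]

section Matrices

/-- The matrix with the given family of entries. -/
def entriesToMatrix {n : ℕ} {F : Type} (x : PiLp 2 (fun _ : Fin n × Fin n => F)) :
    Matrix (Fin n) (Fin n) F :=
  Matrix.of fun i j => x (i, j)

variable (n : ℕ) (F : Type) [NormedRing F] [StarRing F] [InnerProductSpace ℝ F] [StarModule ℝ F]

/-- The real vector space `E(n, F)` of traceless Hermitian `n × n` matrices over `F`, with the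
Euclidean inner product `⟨A, B⟩ = ∑ i j, ⟨A i j, B i j⟩ = Re (tr (A B*))` (the one of the `ℓ²`
product of the entries). -/
def HermitianTraceless : Submodule ℝ (PiLp 2 (fun _ : Fin n × Fin n => F)) where
  carrier := {x | (entriesToMatrix x).IsHermitian ∧ (entriesToMatrix x).trace = 0}
  zero_mem' := by
    constructor
    · ext i j; simp [entriesToMatrix]
    · simp [entriesToMatrix, Matrix.trace]
  add_mem' := by
    rintro x y ⟨hx, hx'⟩ ⟨hy, hy'⟩
    have h : entriesToMatrix (x + y) = entriesToMatrix x + entriesToMatrix y := by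
      ext i j; simp [entriesToMatrix]
    refine ⟨?_, ?_⟩
    · rw [h]; exact hx.add hy
    · rw [h, Matrix.trace_add, hx', hy', add_zero]
  smul_mem' := by
    rintro c x ⟨hx, hx'⟩
    have h : entriesToMatrix (c • x) = c • entriesToMatrix x := by
      ext i j; simp [entriesToMatrix]
    refine ⟨?_, ?_⟩
    · rw [h, Matrix.IsHermitian, Matrix.conjTranspose_smul, hx.eq, star_trivial]
    · rw [h, Matrix.trace_smul, hx', smul_zero]

variable {n F}

/-- The underlying matrix of an element of `E(n, F)`. -/
def toMat (A : HermitianTraceless n F) : Matrix (Fin n) (Fin n) F :=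
  entriesToMatrix (A : PiLp 2 (fun _ : Fin n × Fin n => F))

/-- The function `F_k(A) = tr (A ^ k)` on `E(n, F)`. This trace is real since `A` is Hermitian,
and `⟨1, a⟩` is the real part of `a`. -/
def powerTrace (k : ℕ) (A : HermitianTraceless n F) : ℝ :=
  inner ℝ (1 : F) ((toMat A ^ k).trace)

/-- The map `Φ(A) = (tr A ^ 3, tr A ^ 5, …, tr A ^ (2 p + 1))`, where `p = ⌊(n - 1) / 2⌋`. -/
def oddPowerTraces (A : HermitianTraceless n F) : Fin ((n - 1) / 2) → ℝ :=
  fun i => powerTrace (2 * (i : ℕ) + 3) A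

variable (n F)

/-- The set `B_{n,F}` of the points `A` of the unit sphere `S(n, F)` of `E(n, F)` with `Φ(A) = 0`
which are regular for the restriction of `Φ` to `S(n, F)`: the differential is surjective on the
tangent space `A^⊥` of the sphere. -/
def regularZeros : Set (HermitianTraceless n F) :=
  {A | A ∈ Metric.sphere (0 : HermitianTraceless n F) 1 ∧ oddPowerTraces A = 0 ∧
    Function.Surjective ((fderiv ℝ (oddPowerTraces (n := n) (F := F)) A).comp (ℝ ∙ A)ᗮ.subtypeL)}

/-- The part of `B_{n,F}` consisting of invertible matrices. -/
def invertibleRegularZeros : Set (HermitianTraceless n F) :=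
  {A | A ∈ regularZeros n F ∧ IsUnit (toMat A)}

variable [FiniteDimensional ℝ F]

instance instCompleteSpaceHermitianTraceless : CompleteSpace (HermitianTraceless n F) :=
  FiniteDimensional.complete ℝ _

/-- The length of the gradient on `S(4, F)` of `f₃(A) = tr (A ^ 3)`. -/
def gradLength (A : HermitianTraceless 4 F) : ℝ :=
  ‖sphereGrad (powerTrace 3) A‖

/-- The normalized gradient on `S(4, F)` of `f₃(A) = tr (A ^ 3)`. -/
def unitGrad (A : HermitianTraceless 4 F) : HermitianTraceless 4 F :=
  (gradLength F A)⁻¹ • sphereGrad (powerTrace 3) A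

end Matrices

end

/-!
Let `B` be a symmetric bilinear product on a Euclidean space for which `⟨B u v, w⟩` is symmetric in
all three variables (`IsCubicProduct`). The gradient of the cubic form `⟨B x x, x⟩` is `3 B x x`, so
that the regular zeros of this form on the unit sphere are a regular level set of a map to `ℝ²`: an
embedded orientable hypersurface of the sphere with the unit normal `B x x / ‖B x x‖`, whose shape
operator is the compression of `-2 ‖B x x‖⁻¹ B x` to the orthogonal complement of `x` and `B x x`
(`IsCubicProduct.inner_shapeOperator`). An isometric automorphism of `B` which maps `x` to `-x`
conjugates the shape operator to its negative, whence the hypersurface is austere as soon as there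
is such an automorphism for each `x` (`IsCubicProduct.isAustere`).

On `E(4, F)` the cubic form `tr A ^ 3` belongs to the traceless part of the Jordan product
(`jordan`). The spectral theorem over `F` (`exists_frame_eigenvectors`), proved uniformly from the
common properties of `ℝ`, `ℂ`, `ℍ` collected in `IsHurwitz`, diagonalizes `A`; as the sum of the
eigenvalues and the sum of their cubes vanish, the eigenvalues are `l₁, -l₁, l₂, -l₂`
(`exists_perm_eq_of_sum_eq_zero`). Here `l₁ ^ 2 + l₂ ^ 2 = 1 / 2` and the norm of `B A A` is
`l₁ ^ 2 - l₂ ^ 2`, so that the invertible matrices are singled out by the open condition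
`‖B A A‖ < 1 / 2` (`invertibleRegularZeros_eq`). The permutation matrix which exchanges each
eigenvalue with its negative provides the automorphism which maps `A` to `-A`. A matrix with only
the entries `(i, j)` and `(j, i)` different from zero is an eigenvector of `B A` for half the sum of
the corresponding eigenvalues of `A`. This accounts for all principal curvatures, by counting
dimensions (`finrank_eigenspace_unitaryConj_signPairs`).

The nonzero principal curvatures are `±1 / (l₁ - l₂)` and `±1 / (l₁ + l₂)`. They have absolute value
at least `1`, and only finitely many values are possible if `‖B A A‖` is given. As
`B A (B A (B A A)) = B A A / 4` is normal, `‖B A A‖` is constant along the principal directions of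
nonzero curvature. Since a principal curvature is continuous along each of its curvature surfaces,
it is constant there (`IsCubicProduct.isDupin`).

Three orthonormal vectors and the number `l₁` determine `A`. The orthonormal triples in `F⁴` form a
connected set, as each vector of such a triple moves in a sphere of positive dimension while the
others are fixed (`isPreconnected_frames`); thus the hypersurface is connected. It is not compact,
since `‖B A A‖` comes arbitrarily close to `1 / 2` on it without reaching this value.
-/

open scoped ContDiff Topology

noncomputable section

/-! ### Level sets of submersions -/

section LevelSet

/-- The determinant of a block triangular endomorphism `(m, w) ↦ (A m + C w, w)`. -/
theorem LinearMap.det_of_snd_eq {M N : Type*} [AddCommGroup M] [Module ℝ M]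
    [FiniteDimensional ℝ M] [AddCommGroup N] [Module ℝ N] [FiniteDimensional ℝ N]
    (f : (M × N) →ₗ[ℝ] (M × N)) (A : M →ₗ[ℝ] M) (h₁ : ∀ m, f (m, 0) = (A m, 0))
    (h₂ : ∀ w, (f (0, w)).2 = w) : LinearMap.det f = LinearMap.det A := by
  classical
  let b := Module.finBasis ℝ M
  let c := Module.finBasis ℝ N
  have key : LinearMap.toMatrix (b.prod c) (b.prod c) f =
      Matrix.fromBlocks (LinearMap.toMatrix b b A)
        (Matrix.of fun i j => b.repr (f (0, c j)).1 i) 0 1 := by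
    ext i j
    rcases i with i | i <;> rcases j with j | j <;>
      simp [LinearMap.toMatrix_apply, h₁, h₂, Matrix.one_apply, Finsupp.single_apply, eq_comm]
  rw [← LinearMap.det_toMatrix (b.prod c), key, Matrix.det_fromBlocks_zero₂₁, Matrix.det_one,
    mul_one, LinearMap.det_toMatrix]

variable {V : Type} [NormedAddCommGroup V] [InnerProductSpace ℝ V]

theorem fderiv_mem_tangentSpaceOf {d : ℕ} {M : Set V}
    {φ : OpenPartialHomeomorph (EuclideanSpace ℝ (Fin d)) M} (hφ : IsLocalParametrization φ)
    {u : EuclideanSpace ℝ (Fin d)} (hu : u ∈ φ.source) (w : EuclideanSpace ℝ (Fin d)) :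
    fderiv ℝ (fun u => (φ u : V)) u w ∈ tangentSpaceOf M (φ u : V) := by
  apply Submodule.subset_span
  have hl : ContDiffAt ℝ ∞ (fun t : ℝ => u + t • w) 0 := by fun_prop
  have hsm : ContDiffAt ℝ ∞ (fun u => (φ u : V)) u :=
    hφ.contDiffOn.contDiffAt (φ.open_source.mem_nhds hu)
  refine ⟨fun t => (φ (u + t • w) : V), ?_, by simp, Filter.Eventually.of_forall fun t =>
    (φ (u + t • w)).2, ?_⟩
  · exact ContDiffAt.comp (0 : ℝ) (g := fun u => (φ u : V)) (f := fun t : ℝ => u + t • w)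
      (by simpa using hsm) hl
  · have h1 : HasFDerivAt (fun u => (φ u : V)) (fderiv ℝ (fun u => (φ u : V)) u)
        (u + (0 : ℝ) • w) := by simpa using (hsm.differentiableAt (by simp)).hasFDerivAt
    have h2 : HasDerivAt (fun t : ℝ => u + t • w) w 0 := by
      simpa using ((hasDerivAt_id (0 : ℝ)).smul_const w).const_add u
    exact h1.comp_hasDerivAt (0 : ℝ) h2

variable [FiniteDimensional ℝ V]
variable {W : Type*} [NormedAddCommGroup W] [NormedSpace ℝ W]

/-- The inverse function theorem for `y ↦ (L y, g y)`, where the linear map `L` complements the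
derivative of `g` at `x`, provides a local parametrization of a level set of `g` whose inverse is
the restriction of `L`. -/
theorem exists_isLocalParametrization {d : ℕ} {g : V → W} (hg : ContDiff ℝ ∞ g) {c : W}
    {U O : Set V} (hU : IsOpen U) (hO : IsOpen O) {M : Set V} (hM : M = U ∩ g ⁻¹' {c})
    (x : M) (hxO : (x : V) ∈ O) (L : V →L[ℝ] EuclideanSpace ℝ (Fin d))
    (A : V ≃L[ℝ] EuclideanSpace ℝ (Fin d) × W)
    (hA : (A : V →L[ℝ] EuclideanSpace ℝ (Fin d) × W) = L.prod (fderiv ℝ g x)) :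
    ∃ φ : OpenPartialHomeomorph (EuclideanSpace ℝ (Fin d)) M, IsLocalParametrization φ ∧
      x ∈ φ.target ∧ ∀ y ∈ φ.target, φ.symm y = L y ∧ (y : V) ∈ O := by
  classical
  have hGs : ContDiff ℝ ∞ (fun y => (L y, g y)) := L.contDiff.prodMk hg
  have hd : ∀ y, HasFDerivAt (fun y => (L y, g y)) (L.prod (fderiv ℝ g y)) y := fun y =>
    L.hasFDerivAt.prodMk (hg.differentiable (by simp) y).hasFDerivAt
  have hdx : HasFDerivAt (fun y => (L y, g y))
      (A : V →L[ℝ] EuclideanSpace ℝ (Fin d) × W) (x : V) := hA ▸ hd x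
  have hcd : Continuous fun y => L.prod (fderiv ℝ g y) :=
    ((ContinuousLinearMap.prodₗᵢ ℝ :
      ((V →L[ℝ] EuclideanSpace ℝ (Fin d)) × (V →L[ℝ] W)) ≃ₗᵢ[ℝ]
        (V →L[ℝ] EuclideanSpace ℝ (Fin d) × W))).continuous.comp
        (continuous_const.prodMk (hg.continuous_fderiv (by simp)))
  -- on the smaller domain `O'` the derivative stays invertible, so that the inverse is smooth
  set O' : Set V := O ∩ U ∩ (fun y => L.prod (fderiv ℝ g y)) ⁻¹' Set.range
    ((↑) : (V ≃L[ℝ] EuclideanSpace ℝ (Fin d) × W) → _) with hO'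
  have hO'o : IsOpen O' := (hO.inter hU).inter (ContinuousLinearEquiv.isOpen.preimage hcd)
  have hMU : ∀ y ∈ M, y ∈ U ∧ g y = c := fun y hy => by rw [hM] at hy; exact hy
  have hxM : (x : V) ∈ U ∧ g x = c := hMU x x.2
  have hxO' : (x : V) ∈ O' := ⟨⟨hxO, hxM.1⟩, ⟨A, hA⟩⟩
  set Φ := (hGs.contDiffAt.toOpenPartialHomeomorph _ hdx (by simp)).restrOpen O' hO'o with hΦ
  have hΦc : ∀ y, Φ y = (L y, g y) := fun y => rfl
  have hxΦ : (x : V) ∈ Φ.source :=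
    ⟨ContDiffAt.mem_toOpenPartialHomeomorph_source hGs.contDiffAt hdx (by simp), hxO'⟩
  have hΦO : ∀ y ∈ Φ.source, y ∈ O' := fun y hy => hy.2
  have hinv : ∀ p ∈ Φ.target, L (Φ.symm p) = p.1 ∧ g (Φ.symm p) = p.2 := by
    intro p hp
    have := Φ.right_inv hp
    rw [hΦc] at this
    exact ⟨congrArg Prod.fst this, congrArg Prod.snd this⟩
  have hsm : ∀ p ∈ Φ.target, ContDiffAt ℝ ∞ Φ.symm p := by
    intro p hp
    obtain ⟨A', hA'⟩ := (hΦO _ (Φ.map_target hp)).2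
    refine Φ.contDiffAt_symm (f₀' := A') hp ?_ hGs.contDiffAt
    rw [hA']
    exact hd _
  have hmem : ∀ u, (u, c) ∈ Φ.target → Φ.symm (u, c) ∈ M := by
    intro u hu
    rw [hM]
    exact ⟨(hΦO _ (Φ.map_target hu)).1.2, (hinv _ hu).2⟩
  have hgM : ∀ y : M, g y = c := fun y => (hMU y y.2).2
  set s : Set (EuclideanSpace ℝ (Fin d)) := {u | (u, c) ∈ Φ.target} with hs
  have hso : IsOpen s := Φ.open_target.preimage (by fun_prop)
  -- the parametrization is the slice of the local inverse at the level `c`; its value off the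
  -- source `s` is immaterial
  let F : EuclideanSpace ℝ (Fin d) → M :=
    fun u => if h : (u, c) ∈ Φ.target then ⟨Φ.symm (u, c), hmem u h⟩ else x
  have hF : ∀ u ∈ s, (F u : V) = Φ.symm (u, c) := by
    intro u hu
    have hu' : (u, c) ∈ Φ.target := hu
    simp [F, hu']
  have hpair : ∀ y : M, Φ y = (L y, c) := fun y => by rw [hΦc, hgM]
  let φ : OpenPartialHomeomorph (EuclideanSpace ℝ (Fin d)) M :=
    { toFun := F
      invFun := fun y => L y
      source := s
      target := {y | (y : V) ∈ Φ.source}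
      map_source' := fun u hu => by
        change (F u : V) ∈ Φ.source
        rw [hF u hu]; exact Φ.map_target hu
      map_target' := fun y hy => by
        change (L y, c) ∈ Φ.target
        rw [← hpair]; exact Φ.map_source hy
      left_inv' := fun u hu => by
        rw [hF u hu]; exact (hinv _ hu).1
      right_inv' := fun y hy => by
        have hy' : (L y, c) ∈ Φ.target := by rw [← hpair]; exact Φ.map_source hy
        apply Subtype.ext
        rw [hF _ hy', ← hpair]
        exact Φ.left_inv hy
      open_source := hso
      open_target := Φ.open_source.preimage continuous_subtype_val
      continuousOn_toFun := by
        rw [Topology.IsInducing.subtypeVal.continuousOn_iff]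
        have : ContinuousOn (fun u => Φ.symm (u, c)) s :=
          Φ.continuousOn_symm.comp (by fun_prop) (fun u hu => hu)
        exact this.congr (fun u hu => hF u hu)
      continuousOn_invFun := (L.continuous.comp continuous_subtype_val).continuousOn }
  have hsmF : ∀ u ∈ s, ContDiffAt ℝ ∞ (fun u => (F u : V)) u := by
    intro u hu
    have h1 : ContDiffAt ℝ ∞ (fun u => Φ.symm (u, c)) u :=
      ContDiffAt.comp u (f := fun u => (u, c)) (hsm (u, c) hu) (by fun_prop)
    exact h1.congr_of_eventuallyEq
      (Filter.eventuallyEq_of_mem (hso.mem_nhds hu) (fun v hv => hF v hv))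
  refine ⟨φ, ⟨fun u hu => (hsmF u hu).contDiffWithinAt, ?_⟩, hxΦ,
    fun y hy => ⟨rfl, (hΦO _ hy).1.1⟩⟩
  intro u hu v w hvw
  have h1 : HasFDerivAt (fun u => L (F u : V)) (L.comp (fderiv ℝ (fun u => (F u : V)) u)) u :=
    L.hasFDerivAt.comp u ((hsmF u hu).differentiableAt (by simp)).hasFDerivAt
  have h2 : HasFDerivAt (fun u => L (F u : V))
      (ContinuousLinearMap.id ℝ (EuclideanSpace ℝ (Fin d))) u :=
    (hasFDerivAt_id u).congr_of_eventuallyEq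
      (Filter.eventuallyEq_of_mem (hso.mem_nhds hu) (fun v hv => by
        rw [hF v hv]; exact (hinv _ hv).1))
  -- `L` is a left inverse of the parametrization, and so of its derivative
  have h3 := h1.unique h2
  have h4 := congrArg L hvw
  have e := fun z => congrArg (fun T : _ →L[ℝ] _ => T z) h3
  simp only [ContinuousLinearMap.comp_apply, ContinuousLinearMap.id_apply] at e
  have e1 := e v
  have e2 := e w
  rw [← e1, ← e2]
  exact h4

variable [FiniteDimensional ℝ W]

/-- A linear map onto `ℝ^d` complementing a given surjection `T : V → W`. -/
theorem exists_complementing_equiv {d : ℕ} (T : V →L[ℝ] W) (hT : Function.Surjective T)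
    (hd : Module.finrank ℝ V = d + Module.finrank ℝ W) :
    ∃ (L : V →L[ℝ] EuclideanSpace ℝ (Fin d)) (A : V ≃L[ℝ] EuclideanSpace ℝ (Fin d) × W),
      (A : V →L[ℝ] EuclideanSpace ℝ (Fin d) × W) = L.prod T := by
  have hk : Module.finrank ℝ (LinearMap.ker (T : V →ₗ[ℝ] W)) = d := by
    have h1 := LinearMap.finrank_range_add_finrank_ker (T : V →ₗ[ℝ] W)
    have h2 : LinearMap.range (T : V →ₗ[ℝ] W) = ⊤ := LinearMap.range_eq_top.2 hT
    rw [h2, finrank_top] at h1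
    omega
  let e : LinearMap.ker (T : V →ₗ[ℝ] W) ≃L[ℝ] EuclideanSpace ℝ (Fin d) :=
    ContinuousLinearEquiv.ofFinrankEq (by rw [hk]; simp)
  let L : V →L[ℝ] EuclideanSpace ℝ (Fin d) :=
    (e : _ →L[ℝ] _).comp (LinearMap.ker (T : V →ₗ[ℝ] W)).orthogonalProjectionOnto
  have hinj : Function.Injective (L.prod T) := by
    rw [injective_iff_map_eq_zero]
    intro v hv
    have hv1 : L v = 0 := congrArg Prod.fst hv
    have hv2 : T v = 0 := congrArg Prod.snd hv
    have hvk : v ∈ LinearMap.ker (T : V →ₗ[ℝ] W) := hv2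
    have h3 : (LinearMap.ker (T : V →ₗ[ℝ] W)).orthogonalProjectionOnto v = 0 :=
      e.injective (by simpa [L] using hv1)
    have h4 := Submodule.orthogonalProjectionOnto_mem_subspace_eq_self
      (⟨v, hvk⟩ : LinearMap.ker (T : V →ₗ[ℝ] W))
    rw [h3] at h4
    exact (congrArg Subtype.val h4).symm
  have hfr : Module.finrank ℝ V = Module.finrank ℝ (EuclideanSpace ℝ (Fin d) × W) := by
    rw [hd, Module.finrank_prod, finrank_euclideanSpace_fin]
  refine ⟨L, (LinearEquiv.ofInjectiveOfFinrankEq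
    ((L.prod T : V →L[ℝ] _) : V →ₗ[ℝ] _) hinj hfr).toContinuousLinearEquiv, ?_⟩
  ext1 v
  rfl

theorem isEmbeddedSubmanifold_levelSet {d : ℕ} {g : V → W} (hg : ContDiff ℝ ∞ g) {c : W}
    {U : Set V} (hU : IsOpen U) {M : Set V} (hM : M = U ∩ g ⁻¹' {c})
    (hs : ∀ x ∈ M, Function.Surjective (fderiv ℝ g x))
    (hd : Module.finrank ℝ V = d + Module.finrank ℝ W) : IsEmbeddedSubmanifold d M := by
  intro x
  obtain ⟨L, A, hA⟩ := exists_complementing_equiv (fderiv ℝ g x) (hs x x.2) hd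
  obtain ⟨φ, h1, h2, -⟩ :=
    exists_isLocalParametrization hg hU isOpen_univ hM x (Set.mem_univ _) L A hA
  exact ⟨φ, h1, h2⟩

theorem tangentSpaceOf_levelSet {g : V → W} (hg : ContDiff ℝ ∞ g) {c : W}
    {U : Set V} (hU : IsOpen U) {M : Set V} (hM : M = U ∩ g ⁻¹' {c})
    {x : V} (hx : x ∈ M) (hs : Function.Surjective (fderiv ℝ g x)) :
    tangentSpaceOf M x = LinearMap.ker (fderiv ℝ g x : V →ₗ[ℝ] W) := by
  have hMU : ∀ y ∈ M, y ∈ U ∧ g y = c := fun y hy => by rw [hM] at hy; exact hy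
  apply le_antisymm
  · refine Submodule.span_le.2 ?_
    rintro v ⟨γ, hγ, rfl, hγM, hv⟩
    have h1 : HasDerivAt (fun t => g (γ t)) (fderiv ℝ g (γ 0) v) 0 :=
      ((hg.differentiable (by simp) (γ 0)).hasFDerivAt).comp_hasDerivAt 0 hv
    have h2 : HasDerivAt (fun t => g (γ t)) 0 0 := by
      refine (hasDerivAt_const (0 : ℝ) c).congr_of_eventuallyEq ?_
      filter_upwards [hγM] with t ht
      exact (hMU _ ht).2
    exact h1.unique h2
  · intro v hv
    have hle := LinearMap.finrank_le_finrank_of_injective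
      (f := (LinearMap.range (fderiv ℝ g x : V →ₗ[ℝ] W)).subtype) (Submodule.injective_subtype _)
    have hr := LinearMap.finrank_range_add_finrank_ker (fderiv ℝ g x : V →ₗ[ℝ] W)
    rw [LinearMap.range_eq_top.2 hs, finrank_top] at hr
    obtain ⟨L, A, hA⟩ := exists_complementing_equiv
      (d := Module.finrank ℝ (LinearMap.ker (fderiv ℝ g x : V →ₗ[ℝ] W)))
      (fderiv ℝ g x) hs (by omega)
    obtain ⟨φ, h1, h2, h3⟩ := exists_isLocalParametrization hg hU isOpen_univ hM ⟨x, hx⟩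
      (Set.mem_univ _) L A hA
    set u := φ.symm ⟨x, hx⟩ with hu
    have hus : u ∈ φ.source := φ.map_target h2
    have hφu : φ u = ⟨x, hx⟩ := φ.right_inv h2
    have hsm : ContDiffAt ℝ ∞ (fun u => (φ u : V)) u :=
      h1.contDiffOn.contDiffAt (φ.open_source.mem_nhds hus)
    have hmem := fderiv_mem_tangentSpaceOf h1 hus (L v)
    rw [hφu] at hmem
    -- `A` maps both vectors to `(L v, 0)`
    suffices h : fderiv ℝ (fun u => (φ u : V)) u (L v) = v by rwa [h] at hmem
    apply A.injective
    have hfd : HasFDerivAt (fun u => (φ u : V)) (fderiv ℝ (fun u => (φ u : V)) u) u :=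
      (hsm.differentiableAt (by simp)).hasFDerivAt
    have e1 : L.comp (fderiv ℝ (fun u => (φ u : V)) u) = ContinuousLinearMap.id ℝ _ := by
      have a1 := L.hasFDerivAt.comp u hfd
      refine a1.unique ((hasFDerivAt_id u).congr_of_eventuallyEq ?_)
      filter_upwards [φ.open_source.mem_nhds hus] with w hw
      change L (φ w : V) = w
      rw [← (h3 _ (φ.map_source hw)).1, φ.left_inv hw]
    have e2 : (fderiv ℝ g x).comp (fderiv ℝ (fun u => (φ u : V)) u) = 0 := by
      have hgx : HasFDerivAt g (fderiv ℝ g x) (φ u : V) := by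
        rw [hφu]; exact (hg.differentiable (by simp) x).hasFDerivAt
      have a1 := hgx.comp u hfd
      refine a1.unique ((hasFDerivAt_const c u).congr_of_eventuallyEq ?_)
      refine Filter.Eventually.of_forall fun w => ?_
      exact (hMU _ (φ w).2).2
    have hA' : ∀ z, A z = (L z, fderiv ℝ g x z) := fun z => by
      rw [← ContinuousLinearEquiv.coe_coe, hA]; rfl
    rw [hA', hA', show fderiv ℝ g x v = 0 from hv]
    exact Prod.ext (congrArg (fun T : _ →L[ℝ] _ => T (L v)) e1)
      (congrArg (fun T : _ →L[ℝ] _ => T (L v)) e2)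

/-- A level set of a submersion is orientable: a parametrization whose inverse is the restriction
of a linear map `L` is admitted to the atlas if `(L, Dg)` is positively oriented along it, for an
orientation fixed in advance on the ambient space. -/
theorem isOrientableSubmanifold_levelSet {d : ℕ} (hd0 : 0 < d) {g : V → W}
    (hg : ContDiff ℝ ∞ g) {c : W} {U : Set V} (hU : IsOpen U) {M : Set V}
    (hM : M = U ∩ g ⁻¹' {c}) (hs : ∀ x ∈ M, Function.Surjective (fderiv ℝ g x))
    (hd : Module.finrank ℝ V = d + Module.finrank ℝ W) : IsOrientableSubmanifold d M := by
  have hfr : Module.finrank ℝ (EuclideanSpace ℝ (Fin d) × W) = Module.finrank ℝ V := by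
    rw [hd, Module.finrank_prod, finrank_euclideanSpace_fin]
  have hMU : ∀ y ∈ M, y ∈ U ∧ g y = c := fun y hy => by rw [hM] at hy; exact hy
  let Θ : (EuclideanSpace ℝ (Fin d) × W) ≃L[ℝ] V := ContinuousLinearEquiv.ofFinrankEq hfr
  let δ : (V →L[ℝ] EuclideanSpace ℝ (Fin d)) → V → ℝ := fun L y =>
    ((L.prod (fderiv ℝ g y)).comp (Θ : _ →L[ℝ] V)).det
  have hδc : ∀ L, Continuous (δ L) := by
    intro L
    have hcd : Continuous fun y => L.prod (fderiv ℝ g y) :=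
      ((ContinuousLinearMap.prodₗᵢ ℝ :
      ((V →L[ℝ] EuclideanSpace ℝ (Fin d)) × (V →L[ℝ] W)) ≃ₗᵢ[ℝ]
        (V →L[ℝ] EuclideanSpace ℝ (Fin d) × W))).continuous.comp
        (continuous_const.prodMk (hg.continuous_fderiv (by simp)))
    exact ContinuousLinearMap.continuous_det.comp (hcd.clm_comp continuous_const)
  -- the atlas: the inverse of `φ` is the restriction of some `L`, and `(L, Dg)` is positive
  refine ⟨{φ | IsLocalParametrization φ ∧ ∃ L : V →L[ℝ] EuclideanSpace ℝ (Fin d),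
    ∀ y ∈ φ.target, φ.symm y = L y ∧ 0 < δ L y}, fun φ h => h.1, ?_, ?_⟩
  · intro x
    obtain ⟨L, A, hA⟩ := exists_complementing_equiv (fderiv ℝ g x) (hs x x.2) hd
    have hne : δ L x ≠ 0 := by
      have : (L.prod (fderiv ℝ g x)).comp (Θ : _ →L[ℝ] V) = (Θ.trans A).toContinuousLinearMap := by
        rw [← hA]; rfl
      simp only [δ, this]
      exact (LinearEquiv.isUnit_det' (Θ.trans A).toLinearEquiv).ne_zero
    suffices h : ∃ (L : V →L[ℝ] EuclideanSpace ℝ (Fin d))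
        (A : V ≃L[ℝ] EuclideanSpace ℝ (Fin d) × W),
        (A : V →L[ℝ] EuclideanSpace ℝ (Fin d) × W) = L.prod (fderiv ℝ g x) ∧ 0 < δ L x by
      obtain ⟨L, A, hA, hp⟩ := h
      obtain ⟨φ, h1, h2, h3⟩ := exists_isLocalParametrization hg hU
        ((hδc L).isOpen_preimage _ isOpen_Ioi) hM x hp L A hA
      exact ⟨φ, ⟨h1, L, h3⟩, h2⟩
    rcases lt_or_gt_of_ne hne with hneg | hpos
    · -- compose `L` with a reflection of `ℝ^d`
      let e : EuclideanSpace ℝ (Fin d) := EuclideanSpace.single ⟨0, hd0⟩ 1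
      have he : e ≠ 0 := by simp [e]
      let R : EuclideanSpace ℝ (Fin d) ≃L[ℝ] EuclideanSpace ℝ (Fin d) :=
        ((ℝ ∙ e)ᗮ.reflection).toContinuousLinearEquiv
      have hR : LinearMap.det (R : EuclideanSpace ℝ (Fin d) →ₗ[ℝ] _) = -1 := by
        have := ((ℝ ∙ e)ᗮ).det_reflection
        rw [Submodule.orthogonal_orthogonal, finrank_span_singleton he, pow_one] at this
        exact this
      have hcomp : (((R : _ →L[ℝ] _).comp L).prod (fderiv ℝ g x)) =
          (R.prodCongr (ContinuousLinearEquiv.refl ℝ W)).toContinuousLinearMap.comp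
            (L.prod (fderiv ℝ g x)) := by
        ext1 v; rfl
      refine ⟨(R : _ →L[ℝ] _).comp L, A.trans (R.prodCongr (ContinuousLinearEquiv.refl ℝ W)),
        ?_, ?_⟩
      · rw [hcomp, ← hA]; rfl
      · have hdet : δ ((R : _ →L[ℝ] _).comp L) x = -δ L x := by
          change LinearMap.det _ = -LinearMap.det _
          rw [hcomp]
          change LinearMap.det ((LinearMap.prodMap
            (R : EuclideanSpace ℝ (Fin d) →ₗ[ℝ] EuclideanSpace ℝ (Fin d)) LinearMap.id) ∘ₗ
            ((L.prod (fderiv ℝ g x)).comp (Θ : _ →L[ℝ] V)).toLinearMap) = _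
          rw [LinearMap.det_comp, LinearMap.det_prodMap, hR, LinearMap.det_id]
          ring
        rw [hdet]; linarith
    · exact ⟨L, A, hA, hpos⟩
  · rintro φ ⟨hφ, L, hL⟩ ψ ⟨-, L', hL'⟩ u hu
    have hus : u ∈ φ.source := hu.1
    have hut : φ u ∈ ψ.target := by simpa using hu.2
    set y : V := (φ u : V) with hy
    have hp := (hL _ (φ.map_source hus)).2
    have hp' := (hL' _ hut).2
    rw [← hy] at hp hp'
    have hsm : ContDiffAt ℝ ∞ (fun u => (φ u : V)) u :=
      hφ.contDiffOn.contDiffAt (φ.open_source.mem_nhds hus)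
    have hfd : HasFDerivAt (fun u => (φ u : V)) (fderiv ℝ (fun u => (φ u : V)) u) u :=
      (hsm.differentiableAt (by simp)).hasFDerivAt
    set D := fderiv ℝ (fun u => (φ u : V)) u with hD
    have e1 : L.comp D = ContinuousLinearMap.id ℝ _ := by
      refine (L.hasFDerivAt.comp u hfd).unique ((hasFDerivAt_id u).congr_of_eventuallyEq ?_)
      filter_upwards [φ.open_source.mem_nhds hus] with w hw
      change L (φ w : V) = w
      rw [← (hL _ (φ.map_source hw)).1, φ.left_inv hw]
    have e2 : (fderiv ℝ g y).comp D = 0 := by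
      have hgx : HasFDerivAt g (fderiv ℝ g y) y := (hg.differentiable (by simp) y).hasFDerivAt
      refine (hgx.comp u hfd).unique ((hasFDerivAt_const c u).congr_of_eventuallyEq ?_)
      refine Filter.Eventually.of_forall fun w => ?_
      exact (hMU _ (φ w).2).2
    have e3 : fderiv ℝ (φ.trans ψ.symm) u = L'.comp D := by
      refine ((L'.hasFDerivAt.comp u hfd).congr_of_eventuallyEq ?_).fderiv
      filter_upwards [(φ.trans ψ.symm).open_source.mem_nhds hu] with w hw
      change ψ.symm (φ w) = L' (φ w : V)
      exact (hL' _ (by simpa using hw.2)).1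
    rw [e3]
    -- the transition determinant is the quotient of the two ambient determinants
    have hSdet : IsUnit (LinearMap.det
        ((L.prod (fderiv ℝ g y)).comp (Θ : _ →L[ℝ] V)).toLinearMap) := by
      exact isUnit_iff_ne_zero.2 hp.ne'
    let E := LinearEquiv.ofIsUnitDet
      (f := ((L.prod (fderiv ℝ g y)).comp (Θ : _ →L[ℝ] V)).toLinearMap)
      (v := Module.finBasis ℝ _) (v' := Module.finBasis ℝ _)
      (by rw [LinearMap.det_toMatrix]; exact hSdet)
    have hE : ∀ z, E z = (L (Θ z), fderiv ℝ g y (Θ z)) := fun z => rfl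
    have hEs : ∀ z, (L (Θ (E.symm z)), fderiv ℝ g y (Θ (E.symm z))) = z := fun z => by
      rw [← hE, E.apply_symm_apply]
    have hED : ∀ w, Θ (E.symm (w, 0)) = D w := by
      intro w
      have : E.symm (w, 0) = Θ.symm (D w) := by
        rw [LinearEquiv.symm_apply_eq, hE]
        simp only [ContinuousLinearEquiv.apply_symm_apply]
        exact (Prod.ext (congrArg (fun T : _ →L[ℝ] _ => T w) e1)
          (congrArg (fun T : _ →L[ℝ] _ => T w) e2)).symm
      rw [this, ContinuousLinearEquiv.apply_symm_apply]
    have hdet : LinearMap.det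
        (((L'.prod (fderiv ℝ g y)).comp (Θ : _ →L[ℝ] V)).toLinearMap ∘ₗ
          E.symm.toLinearMap) = LinearMap.det (L'.comp D).toLinearMap := by
      apply LinearMap.det_of_snd_eq
      · intro w
        change (L' (Θ (E.symm (w, 0))), fderiv ℝ g y (Θ (E.symm (w, 0)))) = (L' (D w), 0)
        rw [hED]
        exact Prod.ext rfl (congrArg (fun T : _ →L[ℝ] _ => T w) e2)
      · intro w
        exact congrArg Prod.snd (hEs (0, w))
    change 0 < LinearMap.det (L'.comp D).toLinearMap
    rw [← hdet, LinearMap.det_comp]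
    refine mul_pos hp' ?_
    have h1 : LinearMap.det E.symm.toLinearMap * LinearMap.det E.toLinearMap = 1 := by
      rw [← LinearMap.det_comp]
      simp
    have h2 : 0 < LinearMap.det E.toLinearMap := hp
    by_contra h
    nlinarith [mul_nonneg_of_nonpos_of_nonpos (not_lt.1 h) (neg_nonpos.2 h2.le)]

end LevelSet

/-! ### Regular zeros of a cubic form on the unit sphere -/

section Cubic

variable {V : Type} [NormedAddCommGroup V] [InnerProductSpace ℝ V]

/-- The derivative within `M` is determined on tangent vectors of `M`. -/
theorem HasFDerivWithinAt.eq_on_tangentSpaceOf {E : Type*} [NormedAddCommGroup E]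
    [NormedSpace ℝ E] {M : Set V} {x v : V} {f : V → E} {f₁ f₂ : V →L[ℝ] E}
    (h₁ : HasFDerivWithinAt f f₁ M x) (h₂ : HasFDerivWithinAt f f₂ M x)
    (hv : v ∈ tangentSpaceOf M x) : f₁ v = f₂ v := by
  induction hv using Submodule.span_induction with
  | mem v hv =>
    obtain ⟨γ, -, rfl, hγM, hγ⟩ := hv
    have key : ∀ f' : V →L[ℝ] E, HasFDerivWithinAt f f' M (γ 0) →
        HasDerivAt (f ∘ γ) (f' v) 0 := by
      intro f' hf'
      have h0 : HasDerivWithinAt γ v (γ ⁻¹' M) 0 := hγ.hasDerivWithinAt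
      exact (hf'.comp_hasDerivWithinAt (0 : ℝ) h0 (Set.mapsTo_preimage γ M)).hasDerivAt hγM
    exact (key f₁ h₁).unique (key f₂ h₂)
  | zero => simp
  | add v w _ _ hv hw => rw [map_add, map_add, hv, hw]
  | smul c v _ hv => rw [map_smul, map_smul, hv]

/-- A symmetric bilinear product `B` for which the trilinear form `⟨B u v, w⟩` is symmetric. It
encodes the cubic form `x ↦ ⟨B x x, x⟩`, whose gradient is `3 B x x`. -/
structure IsCubicProduct (B : V →L[ℝ] V →L[ℝ] V) : Prop where
  comm : ∀ u v, B u v = B v u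
  inner_right : ∀ u v w, inner ℝ (B u v) w = inner ℝ v (B u w)

/-- The part in `U` of the set of the zeros of the cubic form `x ↦ ⟨B x x, x⟩` on the unit sphere
which are regular. At a zero the gradient `3 B x x` of the cubic form is tangent to the sphere, so
that regularity means `B x x ≠ 0`. -/
def cubicZeros (B : V →L[ℝ] V →L[ℝ] V) (U : Set V) : Set V :=
  {x | x ∈ U ∧ ‖x‖ = 1 ∧ inner ℝ (B x x) x = 0 ∧ B x x ≠ 0}

/-- The squared norm together with the cubic form. -/
def cubicMap (B : V →L[ℝ] V →L[ℝ] V) (x : V) : ℝ × ℝ := (inner ℝ x x, inner ℝ (B x x) x)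

namespace IsCubicProduct

variable {B : V →L[ℝ] V →L[ℝ] V}

theorem contDiff_self : ContDiff ℝ ∞ fun x => B x x := by fun_prop

theorem contDiff_cubicMap : ContDiff ℝ ∞ (cubicMap B) := by
  unfold cubicMap
  exact (contDiff_id.inner ℝ contDiff_id).prodMk (contDiff_self.inner ℝ contDiff_id)

theorem hasFDerivAt_self (hB : IsCubicProduct B) (x : V) :
    HasFDerivAt (fun x => B x x) ((2 : ℝ) • B x) x := by
  have h := (B.hasFDerivAt (x := x)).clm_apply (hasFDerivAt_id x)
  convert! h using 1
  ext v
  simp [two_smul, hB.comm v x]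

theorem hasFDerivAt_cubic (hB : IsCubicProduct B) (x : V) :
    HasFDerivAt (fun x => inner ℝ (B x x) x) ((3 : ℝ) • innerSL ℝ (B x x)) x := by
  have h := (hB.hasFDerivAt_self x).inner ℝ (hasFDerivAt_id x)
  convert! h using 1
  ext v
  simp only [smul_apply, innerSL_apply_apply, smul_eq_mul,
    ContinuousLinearMap.comp_apply, ContinuousLinearMap.prod_apply, fderivInnerCLM_apply,
    ContinuousLinearMap.id_apply, id_eq, inner_smul_left, conj_trivial]
  rw [hB.inner_right, real_inner_comm x (B x v)]
  ring

theorem fderiv_cubicMap_apply (hB : IsCubicProduct B) (x v : V) :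
    fderiv ℝ (cubicMap B) x v = (2 * inner ℝ x v, 3 * inner ℝ (B x x) v) := by
  have h1 : HasFDerivAt (fun x : V => inner ℝ x x) ((2 : ℝ) • innerSL ℝ x) x := by
    have h := (hasFDerivAt_id x).inner ℝ (hasFDerivAt_id x)
    convert! h using 1
    ext v
    simp only [smul_apply, innerSL_apply_apply, smul_eq_mul,
      ContinuousLinearMap.comp_apply, ContinuousLinearMap.prod_apply, fderivInnerCLM_apply,
      ContinuousLinearMap.id_apply, id_eq]
    rw [real_inner_comm v]
    ring
  have h : HasFDerivAt (cubicMap B) _ x := h1.prodMk (hB.hasFDerivAt_cubic x)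
  rw [h.fderiv]
  simp

theorem cubicZeros_eq (U : Set V) :
    cubicZeros B U = (U ∩ {x | B x x ≠ 0}) ∩ cubicMap B ⁻¹' {((1 : ℝ), (0 : ℝ))} := by
  ext x
  simp only [cubicZeros, Set.mem_ofPred_eq, Set.mem_inter_iff, Set.mem_preimage,
    Set.mem_singleton_iff, cubicMap, Prod.mk.injEq, real_inner_self_eq_norm_sq]
  rw [pow_eq_one_iff_of_nonneg (norm_nonneg x) two_ne_zero]
  tauto

theorem isOpen_ne_zero {U : Set V} (hU : IsOpen U) : IsOpen (U ∩ {x | B x x ≠ 0}) :=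
  hU.inter (_root_.isOpen_ne.preimage (contDiff_self (B := B)).continuous)

/-- At a regular zero the gradients of the squared norm and of the cubic form are orthogonal and
different from zero, and so independent. -/
theorem surjective_fderiv_cubicMap (hB : IsCubicProduct B) {U : Set V} {x : V}
    (hx : x ∈ cubicZeros B U) :
    Function.Surjective (fderiv ℝ (cubicMap B) x) := by
  obtain ⟨-, h1, h2, h3⟩ := hx
  rintro ⟨a, b⟩
  have h4 : inner ℝ (B x x) (B x x) ≠ 0 := inner_self_ne_zero.2 h3
  have h5 : inner ℝ x x = 1 := by rw [real_inner_self_eq_norm_sq, h1, one_pow]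
  refine ⟨(a / 2) • x + (b / (3 * inner ℝ (B x x) (B x x))) • B x x, ?_⟩
  rw [hB.fderiv_cubicMap_apply]
  simp only [inner_add_right, inner_smul_right, real_inner_comm (B x x) x, h2, h5]
  ext
  · simp; ring
  · simp; field_simp

variable [FiniteDimensional ℝ V]

theorem mem_tangentSpaceOf (hB : IsCubicProduct B) {U : Set V} (hU : IsOpen U) {x : V}
    (hx : x ∈ cubicZeros B U) {v : V} :
    v ∈ tangentSpaceOf (cubicZeros B U) x ↔ inner ℝ x v = 0 ∧ inner ℝ (B x x) v = 0 := by
  rw [tangentSpaceOf_levelSet contDiff_cubicMap (isOpen_ne_zero hU) (cubicZeros_eq U) hx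
    (hB.surjective_fderiv_cubicMap hx), LinearMap.mem_ker]
  change fderiv ℝ (cubicMap B) x v = 0 ↔ _
  rw [hB.fderiv_cubicMap_apply]
  simp

theorem isEmbeddedSubmanifold (hB : IsCubicProduct B) {U : Set V} (hU : IsOpen U) {d : ℕ}
    (hd : Module.finrank ℝ V = d + 2) : IsEmbeddedSubmanifold d (cubicZeros B U) :=
  isEmbeddedSubmanifold_levelSet contDiff_cubicMap (isOpen_ne_zero hU) (cubicZeros_eq U)
    (fun _ hx => hB.surjective_fderiv_cubicMap hx) (by simp [hd])

theorem isOrientableSubmanifold (hB : IsCubicProduct B) {U : Set V} (hU : IsOpen U) {d : ℕ}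
    (hd0 : 0 < d) (hd : Module.finrank ℝ V = d + 2) : IsOrientableSubmanifold d (cubicZeros B U) :=
  isOrientableSubmanifold_levelSet hd0 contDiff_cubicMap (isOpen_ne_zero hU) (cubicZeros_eq U)
    (fun _ hx => hB.surjective_fderiv_cubicMap hx) (by simp [hd])

theorem finrank_tangentSpaceOf (hB : IsCubicProduct B) {U : Set V} (hU : IsOpen U) {d : ℕ}
    (hd : Module.finrank ℝ V = d + 2) {x : V} (hx : x ∈ cubicZeros B U) :
    Module.finrank ℝ (tangentSpaceOf (cubicZeros B U) x) = d := by
  have hs := hB.surjective_fderiv_cubicMap hx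
  rw [tangentSpaceOf_levelSet contDiff_cubicMap (isOpen_ne_zero hU) (cubicZeros_eq U) hx hs]
  have h := LinearMap.finrank_range_add_finrank_ker (fderiv ℝ (cubicMap B) x : V →ₗ[ℝ] ℝ × ℝ)
  rw [LinearMap.range_eq_top.2 hs, finrank_top, hd] at h
  simp at h
  omega

/-- A normal field along the regular zeros is a multiple of `x ↦ B x x`. -/
theorem normalField_eq (hB : IsCubicProduct B) {U : Set V} (hU : IsOpen U) {ξ : V → V}
    (hξ : IsNormalField (cubicZeros B U) ξ) {x : V} (hx : x ∈ cubicZeros B U) :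
    ξ x = (inner ℝ (ξ x) (B x x) / inner ℝ (B x x) (B x x)) • B x x := by
  obtain ⟨-, h1, h2, h3⟩ := id hx
  have h4 : inner ℝ (B x x) (B x x) ≠ 0 := inner_self_ne_zero.2 h3
  set w := ξ x - (inner ℝ (ξ x) (B x x) / inner ℝ (B x x) (B x x)) • B x x with hw
  have hxw : inner ℝ x w = 0 := by
    rw [hw, inner_sub_right, inner_smul_right, hξ.tangent_sphere x hx,
      real_inner_comm (B x x) x, h2]
    simp
  have hnw : inner ℝ (B x x) w = 0 := by
    rw [hw, inner_sub_right, inner_smul_right, real_inner_comm (ξ x) (B x x)]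
    field_simp
    simp
  have hwT : w ∈ tangentSpaceOf (cubicZeros B U) x := (hB.mem_tangentSpaceOf hU hx).2 ⟨hxw, hnw⟩
  have h5 : inner ℝ w (ξ x) = 0 := (Submodule.mem_orthogonal _ _).1 (hξ.normal x hx) w hwT
  have h6 : inner ℝ w w = 0 := by
    conv_lhs => rw [hw, inner_sub_right]
    rw [← hw, h5, inner_smul_right, real_inner_comm (B x x) w, hnw]
    simp
  rw [← sub_eq_zero, ← hw]
  exact inner_self_eq_zero.1 h6

/-- The shape operator of the regular zeros for the normal field `ξ = c • B x x` is the compression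
of `-2 c B x` to the tangent space. -/
theorem inner_shapeOperator (hB : IsCubicProduct B) {U : Set V} (hU : IsOpen U) {ξ : V → V}
    (hξ : IsNormalField (cubicZeros B U) ξ) {x : V} (hx : x ∈ cubicZeros B U)
    (v w : tangentSpaceOf (cubicZeros B U) x) :
    inner ℝ (shapeOperator (cubicZeros B U) ξ x v : V) (w : V) =
      -2 * (inner ℝ (ξ x) (B x x) / inner ℝ (B x x) (B x x)) * inner ℝ (B x v) (w : V) := by
  obtain ⟨-, h1, h2, h3⟩ := id hx
  have h4 : inner ℝ (B x x) (B x x) ≠ 0 := inner_self_ne_zero.2 h3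
  set c : V → ℝ := fun y => inner ℝ (ξ y) (B y y) / inner ℝ (B y y) (B y y) with hc
  have hdξ : DifferentiableWithinAt ℝ ξ (cubicZeros B U) x :=
    (hξ.contDiffOn x hx).differentiableWithinAt (by simp)
  have hdn : DifferentiableWithinAt ℝ (fun y => B y y) (cubicZeros B U) x :=
    (hB.hasFDerivAt_self x).differentiableAt.differentiableWithinAt
  have hdc : DifferentiableWithinAt ℝ c (cubicZeros B U) x := by
    simp only [hc, div_eq_mul_inv]
    exact (hdξ.inner ℝ hdn).mul ((hdn.inner ℝ hdn).fun_inv h4)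
  have hder : HasFDerivWithinAt ξ (c x • ((2 : ℝ) • B x) +
      (fderivWithin ℝ c (cubicZeros B U) x).smulRight (B x x)) (cubicZeros B U) x :=
    (hdc.hasFDerivWithinAt.smul (hB.hasFDerivAt_self x).hasFDerivWithinAt).congr
      (fun y hy => hB.normalField_eq hU hξ hy) (hB.normalField_eq hU hξ hx)
  -- the derivative of the coefficient contributes a normal term only
  have heq := hdξ.hasFDerivWithinAt.eq_on_tangentSpaceOf hder v.2
  have hS : inner ℝ (shapeOperator (cubicZeros B U) ξ x v : V) (w : V) =
      -inner ℝ (fderivWithin ℝ ξ (cubicZeros B U) x v) (w : V) := by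
    change inner ℝ (-(((tangentSpaceOf (cubicZeros B U) x).orthogonalProjectionOnto
      (fderivWithin ℝ ξ (cubicZeros B U) x v) : tangentSpaceOf (cubicZeros B U) x)) : V) (w : V) = _
    rw [inner_neg_left, ← Submodule.coe_inner,
      Submodule.inner_orthogonalProjectionOnto_eq_of_mem_right]
  have hnw : inner ℝ (B x x) (w : V) = 0 := ((hB.mem_tangentSpaceOf hU hx).1 w.2).2
  rw [hS, heq]
  simp only [add_apply, smul_apply,
    ContinuousLinearMap.smulRight_apply, inner_add_left, inner_smul_left, conj_trivial, hnw]
  ring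

end IsCubicProduct

end Cubic

/-! ### Austerity and principal directions -/

section Austere

variable {V : Type} [NormedAddCommGroup V] [InnerProductSpace ℝ V]

theorem LinearMap.charpoly_neg_roots {E : Type*} [AddCommGroup E] [Module ℝ E]
    [FiniteDimensional ℝ E] (f : E →ₗ[ℝ] E) :
    (-f).charpoly.roots = f.charpoly.roots.map fun κ => -κ := by
  have h : (-f).charpoly =
      Polynomial.C ((-1) ^ Module.finrank ℝ E) * f.charpoly.comp (-Polynomial.X) := by
    apply Polynomial.funext
    intro t
    rw [LinearMap.eval_charpoly, Polynomial.eval_mul, Polynomial.eval_C, Polynomial.eval_comp,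
      Polynomial.eval_neg, Polynomial.eval_X, LinearMap.eval_charpoly, ← LinearMap.det_smul]
    congr 1
    ext v
    simp [add_comm]
  rw [h, Polynomial.roots_C_mul _ (by simp), Polynomial.roots_comp_neg_X]

namespace IsCubicProduct

variable [FiniteDimensional ℝ V] {B : V →L[ℝ] V →L[ℝ] V} {U : Set V}

theorem isUnitNormalField (hB : IsCubicProduct B) (hU : IsOpen U) {ξ : V → V}
    (hξ : ∀ x ∈ cubicZeros B U, ξ x = ‖B x x‖⁻¹ • B x x) :
    IsUnitNormalField (cubicZeros B U) ξ := by
  refine ⟨⟨?_, fun x hx => ?_, fun x hx => ?_⟩, fun x hx => ?_⟩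
  · have h : ContDiffOn ℝ ∞ (fun x => ‖B x x‖⁻¹ • B x x) (cubicZeros B U) := fun x hx =>
      ((contDiff_self.contDiffAt.norm ℝ hx.2.2.2).inv (norm_ne_zero_iff.2 hx.2.2.2)).smul
        contDiff_self.contDiffAt |>.contDiffWithinAt
    exact h.congr hξ
  · rw [hξ x hx, inner_smul_right, real_inner_comm, hx.2.2.1, mul_zero]
  · rw [hξ x hx]
    refine Submodule.smul_mem _ _ ((Submodule.mem_orthogonal' _ _).2 fun v hv => ?_)
    exact ((hB.mem_tangentSpaceOf hU hx).1 hv).2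
  · rw [hξ x hx, norm_smul, norm_inv, norm_norm, inv_mul_cancel₀ (norm_ne_zero_iff.2 hx.2.2.2)]

/-- If some isometric automorphism of the product `B` maps `x` to `-x`, then it conjugates the
shape operator in any normal direction to its negative. -/
theorem isAustere (hB : IsCubicProduct B) (hU : IsOpen U)
    (hJ : ∀ x ∈ cubicZeros B U, ∃ J : V ≃ₗᵢ[ℝ] V, J x = -x ∧ ∀ v w, B (J v) (J w) = J (B v w)) :
    IsAustere (cubicZeros B U) := by
  intro W ξ hW hξ x hx
  have hUW : cubicZeros B U ∩ W = cubicZeros B (U ∩ W) := by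
    ext y
    simp only [cubicZeros, Set.mem_inter_iff, Set.mem_ofPred_eq]
    tauto
  obtain ⟨J, hJx, hJB⟩ := hJ x hx.1
  rw [hUW] at hξ hx ⊢
  have hUo : IsOpen (U ∩ W) := hU.inter hW
  have hJn : J (B x x) = B x x := by rw [← hJB, hJx]; simp
  have hJT : ∀ v, J v ∈ tangentSpaceOf (cubicZeros B (U ∩ W)) x ↔
      v ∈ tangentSpaceOf (cubicZeros B (U ∩ W)) x := by
    intro v
    rw [hB.mem_tangentSpaceOf hUo hx, hB.mem_tangentSpaceOf hUo hx]
    have e1 : inner ℝ x (J v) = -inner ℝ x v := by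
      rw [← J.inner_map_map x v, hJx, inner_neg_left, neg_neg]
    have e2 : inner ℝ (B x x) (J v) = inner ℝ (B x x) v := by
      rw [← J.inner_map_map (B x x) v, hJn]
    rw [e1, e2, neg_eq_zero]
  let JT : tangentSpaceOf (cubicZeros B (U ∩ W)) x ≃ₗ[ℝ] tangentSpaceOf (cubicZeros B (U ∩ W)) x :=
    LinearEquiv.ofSubmodules J.toLinearEquiv _ _ (by
      ext v
      rw [Submodule.mem_map]
      constructor
      · rintro ⟨w, hw, rfl⟩
        exact (hJT w).2 hw
      · intro hv
        exact ⟨J.symm v, (hJT _).1 (by simpa using hv), by simp⟩)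
  have hJT' : ∀ v, (JT v : V) = J v := fun v => rfl
  set S := shapeOperator (cubicZeros B (U ∩ W)) ξ x with hS
  have hconj : JT.conj S = -S := by
    ext v
    obtain ⟨u, rfl⟩ := JT.surjective v
    rw [LinearEquiv.conj_apply_apply, JT.symm_apply_apply]
    refine congrArg Subtype.val (ext_inner_right ℝ fun w => ?_ : JT (S u) = (-S) (JT u))
    obtain ⟨w, rfl⟩ := JT.surjective w
    have e1 := hB.inner_shapeOperator hUo hξ hx u w
    have e2 := hB.inner_shapeOperator hUo hξ hx (JT u) (JT w)
    have e3 : B x (J u) = -J (B x u) := by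
      rw [← hJB, hJx]; simp
    rw [hJT' u, hJT' w, e3, inner_neg_left, J.inner_map_map, mul_neg, ← e1, ← hS] at e2
    rw [LinearMap.neg_apply, inner_neg_left, Submodule.coe_inner, Submodule.coe_inner, hJT' w, e2,
      hJT' (S u), J.inner_map_map, neg_neg]
  unfold principalCurvatures
  rw [← hS, ← LinearMap.charpoly_neg_roots, ← hconj, LinearEquiv.charpoly_conj]

theorem inner_shapeOperator_unit (hB : IsCubicProduct B) (hU : IsOpen U) {ξ : V → V}
    (hξ : ∀ x ∈ cubicZeros B U, ξ x = ‖B x x‖⁻¹ • B x x) {x : V} (hx : x ∈ cubicZeros B U)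
    (v w : tangentSpaceOf (cubicZeros B U) x) :
    inner ℝ (shapeOperator (cubicZeros B U) ξ x v : V) (w : V) =
      -2 / ‖B x x‖ * inner ℝ (B x v) (w : V) := by
  rw [hB.inner_shapeOperator hU (hB.isUnitNormalField hU hξ).1 hx, hξ x hx, inner_smul_left,
    conj_trivial, mul_div_assoc, div_self (inner_self_ne_zero.2 hx.2.2.2), mul_one]
  ring

theorem mem_eigenspace_shapeOperator (hB : IsCubicProduct B) (hU : IsOpen U) {ξ : V → V}
    (hξ : ∀ x ∈ cubicZeros B U, ξ x = ‖B x x‖⁻¹ • B x x) {x : V} (hx : x ∈ cubicZeros B U)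
    {v : V} (hv : v ∈ tangentSpaceOf (cubicZeros B U) x) {μ β : ℝ}
    (h : B x v = μ • v + β • B x x) :
    (⟨v, hv⟩ : tangentSpaceOf (cubicZeros B U) x) ∈
      (shapeOperator (cubicZeros B U) ξ x).eigenspace (-2 / ‖B x x‖ * μ) := by
  rw [Module.End.mem_eigenspace_iff]
  refine ext_inner_right ℝ fun w => ?_
  have hw := ((hB.mem_tangentSpaceOf hU hx).1 w.2).2
  rw [Submodule.coe_inner, hB.inner_shapeOperator_unit hU hξ hx, h, Submodule.coe_inner,
    inner_add_left, inner_smul_left _ _ β, hw]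
  simp only [inner_smul_left, Submodule.coe_smul, conj_trivial]
  ring

/-- If `B x (B x (B x x))` is normal, then `‖B x x‖` is constant along the principal directions
of nonzero principal curvature. -/
theorem inner_eq_zero_of_eigenvector (hB : IsCubicProduct B) (hU : IsOpen U) {ξ : V → V}
    (hξ : ∀ x ∈ cubicZeros B U, ξ x = ‖B x x‖⁻¹ • B x x) {x : V} (hx : x ∈ cubicZeros B U)
    {β : ℝ} (hβ : B x (B x (B x x)) = β • B x x) {κ : ℝ} (hκ : κ ≠ 0)
    {v : tangentSpaceOf (cubicZeros B U) x}
    (hv : shapeOperator (cubicZeros B U) ξ x v = κ • v) :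
    inner ℝ (B x v) (B x x) = 0 := by
  obtain ⟨-, h1, h2, h3⟩ := id hx
  have h5 : inner ℝ x x = 1 := by rw [real_inner_self_eq_norm_sq, h1, one_pow]
  obtain ⟨hxv, hnv⟩ := (hB.mem_tangentSpaceOf hU hx).1 v.2
  set p := B x (B x x) with hp
  -- the eigenvector equation is tested against the tangent part of `p`, which `B x` maps to a
  -- normal vector
  set w := p - inner ℝ x p • x with hw
  have hpn : inner ℝ (B x x) p = 0 := by
    rw [hp, hB.inner_right, ← hp, hβ, inner_smul_right, real_inner_comm, h2, mul_zero]
  have hwT : w ∈ tangentSpaceOf (cubicZeros B U) x := by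
    rw [hB.mem_tangentSpaceOf hU hx, hw]
    simp only [inner_sub_right, inner_smul_right, h5, hpn, h2]
    simp
  have hBw : B x w = (β - inner ℝ x p) • B x x := by
    rw [hw, map_sub, map_smul, hβ, sub_smul]
  have h6 := hB.inner_shapeOperator_unit hU hξ hx v ⟨w, hwT⟩
  rw [hv, hB.inner_right, hBw, inner_smul_right, real_inner_comm (B x x), hnv] at h6
  have h7 : inner ℝ (v : V) w = 0 := by
    simpa [inner_smul_left, hκ] using h6
  rw [hB.inner_right, ← hp]
  rw [hw, inner_sub_right, inner_smul_right, real_inner_comm x (v : V), hxv] at h7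
  simpa using h7

end IsCubicProduct

end Austere

/-! ### Eigenspaces and curvature surfaces -/

section CurvatureSurfaces

theorem Module.End.sum_finrank_eigenspace_le {ι E : Type*} [Fintype ι] [AddCommGroup E]
    [Module ℝ E] [FiniteDimensional ℝ E] (f : Module.End ℝ E) {κ : ι → ℝ}
    (hκ : Function.Injective κ) :
    ∑ i, Module.finrank ℝ (f.eigenspace (κ i)) ≤ Module.finrank ℝ E := by
  classical
  have h := (f.eigenspaces_iSupIndep.comp hκ).dfinsupp_lsum_injective
  have h2 := LinearMap.finrank_le_finrank_of_injective h
  exact (Module.finrank_directSum (R := ℝ) fun i => f.eigenspace (κ i)).symm.le.trans h2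

/-- Lower bounds for the dimensions of some eigenspaces which add up to the dimension of the whole
space are sharp, and there are no other eigenvalues. -/
theorem Module.End.finrank_eigenspace_of_sum_le {ι E : Type*} [Fintype ι] [AddCommGroup E]
    [Module ℝ E] [FiniteDimensional ℝ E] (f : Module.End ℝ E) {κ : ι → ℝ}
    (hκ : Function.Injective κ) {d : ι → ℕ} (hd : Module.finrank ℝ E ≤ ∑ i, d i)
    (hle : ∀ i, d i ≤ Module.finrank ℝ (f.eigenspace (κ i))) (hpos : ∀ i, 0 < d i) :
    (∀ i, Module.finrank ℝ (f.eigenspace (κ i)) = d i) ∧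
      ∀ c, f.HasEigenvalue c ↔ ∃ i, c = κ i := by
  classical
  refine ⟨fun i => ?_, fun c => ⟨fun hc => ?_, ?_⟩⟩
  · by_contra hne
    have h1 : ∑ i, d i < ∑ i, Module.finrank ℝ (f.eigenspace (κ i)) :=
      Finset.sum_lt_sum (fun i _ => hle i)
        ⟨i, Finset.mem_univ i, lt_of_le_of_ne (hle i) (Ne.symm hne)⟩
    have h2 := f.sum_finrank_eigenspace_le hκ
    omega
  · by_contra hne
    have hinj : Function.Injective (fun o : Option ι => o.elim c κ) := by
      rintro (_ | i) (_ | j) h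
      · rfl
      · exact absurd ⟨j, h⟩ hne
      · exact absurd ⟨i, h.symm⟩ hne
      · exact congrArg some (hκ h)
    have h2 : Module.finrank ℝ (f.eigenspace c) + ∑ i, Module.finrank ℝ (f.eigenspace (κ i)) ≤
        Module.finrank ℝ E := by
      have h := f.sum_finrank_eigenspace_le hinj
      rw [Fintype.sum_option] at h
      exact h
    have h3 : 0 < Module.finrank ℝ (f.eigenspace c) :=
      Module.finrank_pos_iff.2 (Submodule.nontrivial_iff_ne_bot.2 hc)
    have h4 : ∑ i, d i ≤ ∑ i, Module.finrank ℝ (f.eigenspace (κ i)) :=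
      Finset.sum_le_sum fun i _ => hle i
    omega
  · rintro ⟨i, rfl⟩ (h : f.eigenspace (κ i) = ⊥)
    have h1 := hle i
    have h2 := hpos i
    rw [h, finrank_bot] at h1
    omega

variable {V : Type} [NormedAddCommGroup V] [InnerProductSpace ℝ V]

/-- A function on a submanifold whose derivative vanishes along local parametrizations is locally
constant. -/
theorem IsEmbeddedSubmanifold.isLocallyConstant {k : ℕ} {S : Set V} (hS : IsEmbeddedSubmanifold k S)
    {h : V → ℝ} (hd : Differentiable ℝ h)
    (h0 : ∀ x ∈ S, ∀ v ∈ tangentSpaceOf S x, fderiv ℝ h x v = 0) :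
    IsLocallyConstant fun x : S => h x := by
  rw [IsLocallyConstant.iff_eventually_eq]
  intro x
  obtain ⟨φ, hφ, hx⟩ := hS x
  obtain ⟨r, hr, hball⟩ := Metric.isOpen_iff.1 φ.open_source _ (φ.map_target hx)
  set u₀ := φ.symm x with hu₀
  have hcont : Filter.Tendsto φ.symm (𝓝 x) (𝓝 u₀) := φ.continuousAt_symm hx
  have hder : ∀ u ∈ φ.source, HasFDerivAt (fun u => h (φ u : V)) (0 : _ →L[ℝ] ℝ) u := by
    intro u hu
    have hsm : ContDiffAt ℝ ∞ (fun u => (φ u : V)) u :=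
      hφ.contDiffOn.contDiffAt (φ.open_source.mem_nhds hu)
    have h1 := (hd (φ u : V)).hasFDerivAt.comp u (hsm.differentiableAt (by simp)).hasFDerivAt
    convert! h1 using 1
    ext w
    exact (h0 _ (φ u).2 _ (fderiv_mem_tangentSpaceOf hφ hu w)).symm
  filter_upwards [hcont (Metric.ball_mem_nhds u₀ hr), φ.open_target.mem_nhds hx] with y hy hyt
  have hc := (convex_ball u₀ r).is_const_of_fderivWithin_eq_zero (𝕜 := ℝ)
    (f := fun u => h (φ u : V))
    (fun u hu => (hder u (hball hu)).differentiableAt.differentiableWithinAt)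
    (fun u hu => by
      rw [fderivWithin_of_isOpen Metric.isOpen_ball hu, (hder u (hball hu)).fderiv])
    hy (Metric.mem_ball_self hr)
  simp only [φ.right_inv hyt, hu₀, φ.right_inv hx] at hc
  exact hc

namespace IsCubicProduct

variable [FiniteDimensional ℝ V] {B : V →L[ℝ] V →L[ℝ] V} {U : Set V}

/-- Along a curvature surface the principal curvature is continuous: in a local parametrization it
is the Rayleigh quotient of the shape operator at a coordinate vector field. -/
theorem continuous_principalCurvature (hB : IsCubicProduct B) (hU : IsOpen U) {ξ : V → V}
    (hξ : ∀ x ∈ cubicZeros B U, ξ x = ‖B x x‖⁻¹ • B x x) {S : Set V} {κ : V → ℝ}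
    (hS : IsCurvatureSurface (cubicZeros B U) ξ S κ) : Continuous fun x : S => κ x := by
  obtain ⟨k, hk⟩ := hS.submanifold
  rw [continuous_iff_continuousAt]
  intro x
  obtain ⟨φ, hφ, hx⟩ := hk x
  -- a curvature surface of dimension zero is discrete
  rcases Nat.eq_zero_or_pos k with rfl | hkpos
  · refine (continuousAt_const (y := κ x)).congr ?_
    filter_upwards [φ.open_target.mem_nhds hx] with y hy
    have : φ.symm y = φ.symm x := Subsingleton.elim _ _
    rw [← φ.right_inv hy, this, φ.right_inv hx]
  · let e : EuclideanSpace ℝ (Fin k) := EuclideanSpace.single ⟨0, hkpos⟩ 1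
    have he : e ≠ 0 := by simp [e]
    set v : EuclideanSpace ℝ (Fin k) → V := fun u => fderiv ℝ (fun u => (φ u : V)) u e with hv
    have hv0 : ∀ u ∈ φ.source, v u ≠ 0 := fun u hu h =>
      he (hφ.injective_fderiv u hu (by rw [map_zero]; exact h))
    have hvc : ContinuousOn v φ.source :=
      (hφ.contDiffOn.continuousOn_fderiv_of_isOpen φ.open_source (by simp)).clm_apply
        continuousOn_const
    have hφc : ContinuousOn (fun u => (φ u : V)) φ.source := hφ.contDiffOn.continuousOn
    set q : EuclideanSpace ℝ (Fin k) → ℝ := fun u =>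
      -2 / ‖B (φ u) (φ u)‖ * inner ℝ (B (φ u) (v u)) (v u) / inner ℝ (v u) (v u) with hq
    have hqκ : ∀ u ∈ φ.source, κ (φ u) = q u := by
      intro u hu
      have hmem : v u ∈ tangentSpaceOf S (φ u : V) := fderiv_mem_tangentSpaceOf hφ hu e
      rw [hS.tangent_eq _ (φ u).2] at hmem
      obtain ⟨v', hv', hvv'⟩ := hmem
      have h1 := hB.inner_shapeOperator_unit hU hξ (hS.subset (φ u).2) v' v'
      rw [Module.End.mem_eigenspace_iff.1 hv'] at h1
      simp only [Submodule.coe_subtype] at hvv'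
      rw [Submodule.coe_smul, hvv', inner_smul_left, conj_trivial] at h1
      have h2 : inner ℝ (v u) (v u) ≠ 0 := inner_self_ne_zero.2 (hv0 u hu)
      rw [hq, eq_div_iff h2]
      exact h1
    have hqc : ContinuousOn q φ.source := by
      have hBc : ContinuousOn (fun u => B (φ u : V)) φ.source := B.continuous.comp_continuousOn hφc
      refine ContinuousOn.div ((continuousOn_const.div (hBc.clm_apply hφc).norm fun u hu => ?_).mul
        ((hBc.clm_apply hvc).inner hvc)) (hvc.inner hvc) fun u hu => ?_
      · exact norm_ne_zero_iff.2 (hS.subset (φ u).2).2.2.2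
      · exact inner_self_ne_zero.2 (hv0 u hu)
    have h3 : ContinuousAt (fun y => q (φ.symm y)) x :=
      ContinuousAt.comp (hqc.continuousAt (φ.open_source.mem_nhds (φ.map_target hx)))
        (φ.continuousAt_symm hx)
    refine h3.congr ?_
    filter_upwards [φ.open_target.mem_nhds hx] with y hy
    rw [← hqκ _ (φ.map_target hy), φ.right_inv hy]

/-- Suppose that `B x (B x (B x x))` is normal and that the nonzero principal curvatures are
bounded away from `0` and determined up to finitely many choices by `‖B x x‖`. As `‖B x x‖` is
constant along a curvature surface on which the principal curvature is not zero, the principal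
curvature is constant by continuity. -/
theorem isDupin (hB : IsCubicProduct B) (hU : IsOpen U) {ξ : V → V}
    (hξ : ∀ x ∈ cubicZeros B U, ξ x = ‖B x x‖⁻¹ • B x x)
    (hβ : ∀ x ∈ cubicZeros B U, ∃ β : ℝ, B x (B x (B x x)) = β • B x x)
    {ε : ℝ} (hε : 0 < ε)
    (hbd : ∀ x ∈ cubicZeros B U, ∀ κ, (shapeOperator (cubicZeros B U) ξ x).HasEigenvalue κ →
      κ ≠ 0 → ε ≤ |κ|)
    {Λ : ℝ → Set ℝ} (hΛ : ∀ s, (Λ s).Finite)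
    (hval : ∀ x ∈ cubicZeros B U, ∀ κ, (shapeOperator (cubicZeros B U) ξ x).HasEigenvalue κ →
      κ ∈ Λ ‖B x x‖) :
    IsDupin (cubicZeros B U) ξ := by
  intro S κ hS x hx y hy
  have hκc := hB.continuous_principalCurvature hU hξ hS
  have : PreconnectedSpace S := Subtype.preconnectedSpace hS.connected.isPreconnected
  -- by the lower bound for the nonzero values, `κ` vanishes identically or nowhere on `S`
  have hclopen : IsClopen {z : S | κ z = 0} := by
    refine ⟨isClosed_eq hκc continuous_const, ?_⟩
    have : {z : S | κ z = 0} = {z : S | |κ z| < ε} := by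
      ext z
      simp only [Set.mem_ofPred_eq]
      constructor
      · intro h; rw [h, abs_zero]; exact hε
      · intro h
        by_contra hne
        exact absurd (hbd z (hS.subset z.2) _ (hS.hasEigenvalue z z.2) hne) (not_le.2 h)
    rw [this]
    exact isOpen_lt hκc.abs continuous_const
  rcases isClopen_iff.1 hclopen with hempty | huniv
  · have hne : ∀ z ∈ S, κ z ≠ 0 := fun z hz h => by
      have : (⟨z, hz⟩ : S) ∈ {z : S | κ z = 0} := h
      rw [hempty] at this
      exact this
    obtain ⟨k, hk⟩ := hS.submanifold
    have hder : ∀ z, HasFDerivAt (fun z => inner ℝ (B z z) (B z z))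
        ((4 : ℝ) • (innerSL ℝ (B z z)).comp (B z)) z := by
      intro z
      have h := (hB.hasFDerivAt_self z).inner ℝ (hB.hasFDerivAt_self z)
      convert! h using 1
      ext v
      simp only [smul_apply, innerSL_apply_apply, smul_eq_mul,
        ContinuousLinearMap.comp_apply, ContinuousLinearMap.prod_apply, fderivInnerCLM_apply,
        inner_smul_left, inner_smul_right, conj_trivial]
      rw [real_inner_comm (B z z) (B z v)]
      ring
    have hlc : IsLocallyConstant fun z : S => inner ℝ (B (z : V) z) (B (z : V) z) := by
      refine hk.isLocallyConstant (h := fun z => inner ℝ (B z z) (B z z))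
        (fun z => (hder z).differentiableAt) fun z hz v hv => ?_
      rw [hS.tangent_eq z hz] at hv
      obtain ⟨v', hv', rfl⟩ := hv
      obtain ⟨β, hβ'⟩ := hβ z (hS.subset hz)
      have h1 := hB.inner_eq_zero_of_eigenvector hU hξ (hS.subset hz) hβ' (hne z hz)
        (Module.End.mem_eigenspace_iff.1 hv')
      rw [(hder z).fderiv]
      simp only [smul_apply, innerSL_apply_apply, smul_eq_mul,
        ContinuousLinearMap.comp_apply, Submodule.coe_subtype]
      rw [real_inner_comm, h1, mul_zero]
    have hnorm : ∀ z : S, ‖B (z : V) z‖ = ‖B x x‖ := by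
      intro z
      have h1 := hlc.apply_eq_of_preconnectedSpace z ⟨x, hx⟩
      simp only [real_inner_self_eq_norm_sq] at h1
      exact (pow_left_inj₀ (norm_nonneg _) (norm_nonneg _) two_ne_zero).1 h1
    -- a connected set of finitely many numbers has at most one element
    have hfin : (Set.range fun z : S => κ z).Finite := (hΛ ‖B x x‖).subset (by
      rintro _ ⟨z, rfl⟩
      have := hval z (hS.subset z.2) _ (hS.hasEigenvalue z z.2)
      rwa [hnorm] at this)
    exact hfin.countable.isTotallyDisconnected _ subset_rfl
      (isPreconnected_range hκc) ⟨⟨x, hx⟩, rfl⟩ ⟨⟨y, hy⟩, rfl⟩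
  · have h0 : ∀ z : S, κ z = 0 := fun z => by
      have : z ∈ {z : S | κ z = 0} := by rw [huniv]; trivial
      exact this
    rw [h0 ⟨x, hx⟩, h0 ⟨y, hy⟩]

end IsCubicProduct

end CurvatureSurfaces

/-! ### The common properties of `ℝ`, `ℂ`, `ℍ` -/

section Hurwitz

/-- The properties of `ℝ`, `ℂ`, `ℍ` on which the spectral theorem and the calculus of traces rest:
`F` is a real algebra, its self-adjoint elements are the real numbers, and the real part `⟨1, a⟩`
is a trace which induces the inner product. -/
class IsHurwitz (F : Type) [NormedRing F] [StarRing F] [InnerProductSpace ℝ F] : Prop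
    extends IsScalarTower ℝ F F, SMulCommClass ℝ F F where
  norm_one : ‖(1 : F)‖ = 1
  inner_one_mul_comm : ∀ a b : F, inner ℝ 1 (a * b) = inner ℝ 1 (b * a)
  inner_one_star_mul : ∀ a b : F, inner ℝ 1 (star a * b) = inner ℝ a b
  eq_smul_one : ∀ a : F, star a = a → a = (inner ℝ 1 a : ℝ) • (1 : F)

instance : IsHurwitz ℝ where
  norm_one := by simp
  inner_one_mul_comm a b := by simp [mul_comm]
  inner_one_star_mul a b := by simp [mul_comm]
  eq_smul_one a _ := by simp

instance : IsHurwitz ℂ where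
  norm_one := by simp
  inner_one_mul_comm a b := by rw [mul_comm]
  inner_one_star_mul a b := by simp [Complex.inner, mul_comm]
  eq_smul_one a h := by
    have h1 : a.im = 0 := Complex.conj_eq_iff_im.1 h
    apply Complex.ext <;> simp [Complex.inner, h1]

instance : IsHurwitz (Quaternion ℝ) where
  norm_one := by simp
  inner_one_mul_comm a b := by simp [Quaternion.inner_def]; ring
  inner_one_star_mul a b := by simp [Quaternion.inner_def]; ring
  eq_smul_one a h := by
    have h1 : a = (a.re : Quaternion ℝ) := Quaternion.star_eq_self.1 h
    have h2 : inner ℝ 1 a = a.re := by simp [Quaternion.inner_def]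
    rw [h2]
    exact h1.trans (Algebra.algebraMap_eq_smul_one (A := Quaternion ℝ) a.re)

theorem IsRealComplexOrQuaternion.isHurwitz {F : Type} [NormedRing F] [StarRing F]
    [InnerProductSpace ℝ F] (hF : IsRealComplexOrQuaternion F) : IsHurwitz F := by
  cases hF <;> infer_instance

namespace IsHurwitz

variable {F : Type} [NormedRing F] [StarRing F] [InnerProductSpace ℝ F] [IsHurwitz F]

variable (F) in
theorem nontrivial : Nontrivial F :=
  ⟨⟨1, 0, fun h => by
    have h1 := norm_one (F := F)
    rw [h, norm_zero] at h1
    exact zero_ne_one h1⟩⟩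

theorem inner_one_one : inner ℝ (1 : F) 1 = 1 := by
  rw [real_inner_self_eq_norm_sq, norm_one, one_pow]

theorem norm_star (a : F) : ‖star a‖ = ‖a‖ := by
  have h : ‖star a‖ ^ 2 = ‖a‖ ^ 2 := by
    rw [← real_inner_self_eq_norm_sq, ← real_inner_self_eq_norm_sq, ← inner_one_star_mul,
      ← inner_one_star_mul a, inner_one_mul_comm, star_star]
  exact (pow_left_inj₀ (norm_nonneg _) (norm_nonneg _) two_ne_zero).1 h

end IsHurwitz

end Hurwitz

/-! ### Real traces and the Jordan product of traceless Hermitian matrices -/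

section Jordan

theorem isHermitian_mul_add_mul {n : ℕ} {F : Type} [NormedRing F] [StarRing F]
    {X Y : Matrix (Fin n) (Fin n) F} (hX : X.IsHermitian)
    (hY : Y.IsHermitian) : (X * Y + Y * X).IsHermitian := by
  rw [Matrix.IsHermitian, Matrix.conjTranspose_add, Matrix.conjTranspose_mul,
    Matrix.conjTranspose_mul, hX.eq, hY.eq, add_comm]

variable {n : ℕ} {F : Type} [NormedRing F] [InnerProductSpace ℝ F]

/-- The real part of the trace. -/
def realTrace (X : Matrix (Fin n) (Fin n) F) : ℝ := inner ℝ (1 : F) X.trace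

theorem realTrace_add (X Y : Matrix (Fin n) (Fin n) F) :
    realTrace (X + Y) = realTrace X + realTrace Y := by
  simp [realTrace, inner_add_right]

theorem realTrace_sub (X Y : Matrix (Fin n) (Fin n) F) :
    realTrace (X - Y) = realTrace X - realTrace Y := by
  simp [realTrace, inner_sub_right]

theorem realTrace_smul (r : ℝ) (X : Matrix (Fin n) (Fin n) F) :
    realTrace (r • X) = r * realTrace X := by
  simp [realTrace, inner_smul_right]

section Trace

variable [StarRing F] [IsHurwitz F]

theorem realTrace_mul_comm (X Y : Matrix (Fin n) (Fin n) F) :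
    realTrace (X * Y) = realTrace (Y * X) := by
  simp only [realTrace, Matrix.trace, Matrix.diag, Matrix.mul_apply, inner_sum]
  rw [Finset.sum_comm]
  exact Finset.sum_congr rfl fun _ _ => Finset.sum_congr rfl fun _ _ =>
    IsHurwitz.inner_one_mul_comm _ _

theorem realTrace_conjTranspose_mul (X Y : Matrix (Fin n) (Fin n) F) :
    realTrace (X.conjTranspose * Y) = ∑ i, ∑ j, inner ℝ (X i j) (Y i j) := by
  simp only [realTrace, Matrix.trace, Matrix.diag, Matrix.mul_apply, inner_sum,
    Matrix.conjTranspose_apply, IsHurwitz.inner_one_star_mul]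
  rw [Finset.sum_comm]

theorem realTrace_one : realTrace (1 : Matrix (Fin n) (Fin n) F) = n := by
  simp only [realTrace, Matrix.trace, Matrix.diag, Matrix.one_apply_eq, inner_sum,
    IsHurwitz.inner_one_one]
  simp

theorem Matrix.IsHermitian.trace_eq {X : Matrix (Fin n) (Fin n) F} (hX : X.IsHermitian) :
    X.trace = realTrace X • (1 : F) := by
  apply IsHurwitz.eq_smul_one
  rw [← Matrix.trace_conjTranspose, hX.eq]

end Trace

variable [StarRing F] [StarModule ℝ F]

theorem isHermitian_toMat (A : HermitianTraceless n F) : (toMat A).IsHermitian := A.2.1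

theorem trace_toMat (A : HermitianTraceless n F) : (toMat A).trace = 0 := A.2.2

theorem toMat_injective : Function.Injective (toMat : HermitianTraceless n F → _) := by
  intro A B h
  apply Subtype.ext
  ext ⟨i, j⟩
  exact congrFun (congrFun h i) j

theorem toMat_add (A B : HermitianTraceless n F) : toMat (A + B) = toMat A + toMat B := rfl

theorem toMat_neg (A : HermitianTraceless n F) : toMat (-A) = -toMat A := rfl

theorem toMat_smul (r : ℝ) (A : HermitianTraceless n F) : toMat (r • A) = r • toMat A := rfl

theorem Matrix.IsHermitian.real_smul {X : Matrix (Fin n) (Fin n) F} (hX : X.IsHermitian) (r : ℝ) :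
    (r • X).IsHermitian := by
  rw [Matrix.IsHermitian, Matrix.conjTranspose_smul, hX.eq, star_trivial]

theorem realTrace_toMat (A : HermitianTraceless n F) : realTrace (toMat A) = 0 := by
  rw [realTrace, trace_toMat, inner_zero_right]

variable [IsHurwitz F]

/-- A traceless Hermitian matrix as an element of `E(n, F)`. -/
def ofMat (X : Matrix (Fin n) (Fin n) F) (h : X.IsHermitian) (h' : realTrace X = 0) :
    HermitianTraceless n F :=
  ⟨WithLp.toLp 2 fun p => X p.1 p.2, h, by
    change X.trace = 0
    rw [h.trace_eq, h', zero_smul]⟩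

theorem toMat_ofMat (X : Matrix (Fin n) (Fin n) F) (h : X.IsHermitian) (h' : realTrace X = 0) :
    toMat (ofMat X h h') = X := rfl

theorem inner_eq_realTrace (A B : HermitianTraceless n F) :
    inner ℝ A B = realTrace (toMat A * toMat B) := by
  have h := realTrace_conjTranspose_mul (toMat A) (toMat B)
  rw [(isHermitian_toMat A).eq] at h
  rw [h, Submodule.coe_inner, PiLp.inner_apply, Fintype.sum_prod_type]
  rfl

variable (F) in
/-- The traceless part of the Jordan product `(A B + B A) / 2` on `E(4, F)`. -/
def jordanLin : HermitianTraceless 4 F →ₗ[ℝ] HermitianTraceless 4 F →ₗ[ℝ] HermitianTraceless 4 F :=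
  LinearMap.mk₂ ℝ
    (fun A B => ofMat ((1 / 2 : ℝ) • (toMat A * toMat B + toMat B * toMat A) -
        (inner ℝ A B / 4) • (1 : Matrix (Fin 4) (Fin 4) F))
      (((isHermitian_mul_add_mul (isHermitian_toMat A) (isHermitian_toMat B)).real_smul _).sub
        (Matrix.isHermitian_one.real_smul _))
      (by
        rw [realTrace_sub, realTrace_smul, realTrace_smul, realTrace_add, realTrace_one,
          realTrace_mul_comm (toMat B), ← inner_eq_realTrace]
        push_cast
        ring))
    (fun A A' B => toMat_injective (by
      simp only [toMat_ofMat, toMat_add, add_mul, mul_add, inner_add_left, add_div, add_smul,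
        smul_add]
      abel))
    (fun r A B => toMat_injective (by
      simp only [toMat_ofMat, inner_eq_realTrace, toMat_smul, Matrix.smul_mul, realTrace_smul,
        Matrix.mul_smul, smul_sub, smul_smul, ← smul_add, mul_div_assoc]
      congr 2; ring))
    (fun A B B' => toMat_injective (by
      simp only [toMat_ofMat, toMat_add, add_mul, mul_add, inner_add_right, add_div, add_smul,
        smul_add]
      abel))
    (fun r A B => toMat_injective (by
      simp only [toMat_ofMat, inner_eq_realTrace, toMat_smul, Matrix.smul_mul, realTrace_smul,
        Matrix.mul_smul, smul_sub, smul_smul, ← smul_add, mul_div_assoc]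
      congr 2; ring))

variable [FiniteDimensional ℝ F]

variable (F) in
/-- The traceless part of the Jordan product, as a continuous bilinear map. -/
def jordan : HermitianTraceless 4 F →L[ℝ] HermitianTraceless 4 F →L[ℝ] HermitianTraceless 4 F :=
  (jordanLin F).toContinuousBilinearMap

theorem toMat_jordan (A B : HermitianTraceless 4 F) :
    toMat (jordan F A B) = (1 / 2 : ℝ) • (toMat A * toMat B + toMat B * toMat A) -
      (inner ℝ A B / 4) • (1 : Matrix (Fin 4) (Fin 4) F) := rfl

theorem toMat_jordan_self (A : HermitianTraceless 4 F) :
    toMat (jordan F A A) = toMat A * toMat A - (inner ℝ A A / 4) • 1 := by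
  rw [toMat_jordan, ← two_smul ℝ, smul_smul]
  norm_num

variable (F) in
theorem isCubicProduct_jordan : IsCubicProduct (V := HermitianTraceless 4 F) (jordan F) where
  comm A B := toMat_injective (by rw [toMat_jordan, toMat_jordan, real_inner_comm, add_comm])
  inner_right A B C := by
    rw [inner_eq_realTrace, inner_eq_realTrace, toMat_jordan, toMat_jordan]
    simp only [sub_mul, mul_sub, realTrace_sub, Matrix.smul_mul, Matrix.mul_smul, realTrace_smul,
      add_mul, mul_add, realTrace_add, one_mul, mul_one, realTrace_toMat]
    rw [mul_assoc, realTrace_mul_comm (toMat A), mul_assoc, mul_assoc]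
    ring

theorem powerTrace_three (A : HermitianTraceless 4 F) :
    powerTrace 3 A = inner ℝ (jordan F A A) A := by
  rw [inner_eq_realTrace, toMat_jordan_self, sub_mul, realTrace_sub, Matrix.smul_mul,
    realTrace_smul, one_mul, realTrace_toMat, mul_zero, sub_zero, ← pow_three']
  rfl

end Jordan

/-! ### The trace of the cube as a cubic form -/

section Gradient

variable {F : Type} [NormedRing F] [StarRing F] [InnerProductSpace ℝ F] [IsHurwitz F]
  [StarModule ℝ F] [FiniteDimensional ℝ F]

theorem hasFDerivAt_powerTrace_three (A : HermitianTraceless 4 F) :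
    HasFDerivAt (powerTrace 3 : HermitianTraceless 4 F → ℝ)
      ((3 : ℝ) • innerSL ℝ (jordan F A A)) A := by
  have h := (isCubicProduct_jordan F).hasFDerivAt_cubic A
  have e : (powerTrace 3 : HermitianTraceless 4 F → ℝ) =
      fun A => inner ℝ (jordan F A A) A := funext powerTrace_three
  rw [e]
  exact h

theorem fderiv_oddPowerTraces_apply (A v : HermitianTraceless 4 F) (i : Fin ((4 - 1) / 2)) :
    fderiv ℝ (oddPowerTraces (n := 4) (F := F)) A v i = 3 * inner ℝ (jordan F A A) v := by
  have h : HasFDerivAt (oddPowerTraces (n := 4) (F := F))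
      (ContinuousLinearMap.pi fun _ => (3 : ℝ) • innerSL ℝ (jordan F A A)) A := by
    rw [hasFDerivAt_pi]
    intro i
    have hi : 2 * (i : ℕ) + 3 = 3 := by
      have := i.2
      omega
    simp only [oddPowerTraces, hi]
    exact hasFDerivAt_powerTrace_three A
  rw [h.fderiv]
  rfl

/-- At a zero the gradient of the cubic form is tangent to the sphere, so that the zero is regular
if and only if the gradient is not zero. -/
theorem regularZeros_eq : regularZeros 4 F = cubicZeros (jordan F) Set.univ := by
  ext A
  have hz : oddPowerTraces A = 0 ↔ inner ℝ (jordan F A A) A = 0 := by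
    rw [← powerTrace_three, funext_iff]
    constructor
    · intro h
      exact h ⟨0, by norm_num⟩
    · intro h i
      have hi : 2 * (i : ℕ) + 3 = 3 := by
        have := i.2
        omega
      simp only [oddPowerTraces, hi, h, Pi.zero_apply]
  constructor
  · rintro ⟨h1, h2, h3⟩
    refine ⟨trivial, mem_sphere_zero_iff_norm.1 h1, hz.1 h2, fun h0 => ?_⟩
    obtain ⟨v, hv⟩ := h3 (fun _ => 1)
    have h4 := congrFun hv ⟨0, by norm_num⟩
    change fderiv ℝ (oddPowerTraces (n := 4) (F := F)) A v _ = 1 at h4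
    rw [fderiv_oddPowerTraces_apply, h0, inner_zero_left, mul_zero] at h4
    exact zero_ne_one h4
  · rintro ⟨-, h1, h2, h3⟩
    refine ⟨mem_sphere_zero_iff_norm.2 h1, hz.2 h2, fun y => ?_⟩
    have h4 : inner ℝ (jordan F A A) (jordan F A A) ≠ 0 := inner_self_ne_zero.2 h3
    let i₀ : Fin ((4 - 1) / 2) := ⟨0, by norm_num⟩
    have hmem : jordan F A A ∈ (ℝ ∙ A)ᗮ := by
      rw [Submodule.mem_orthogonal_singleton_iff_inner_left]
      exact h2
    refine ⟨(y i₀ / (3 * inner ℝ (jordan F A A) (jordan F A A))) • ⟨jordan F A A, hmem⟩, ?_⟩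
    ext i
    have hi : i = i₀ := Fin.ext (by have := i.2; simp only [i₀]; omega)
    change fderiv ℝ (oddPowerTraces (n := 4) (F := F)) A
      ((y i₀ / (3 * inner ℝ (jordan F A A) (jordan F A A))) • jordan F A A) i = y i
    rw [map_smul, Pi.smul_apply, fderiv_oddPowerTraces_apply, hi, smul_eq_mul]
    field_simp

theorem sphereGrad_powerTrace_three {A : HermitianTraceless 4 F}
    (hA : inner ℝ (jordan F A A) A = 0) :
    sphereGrad (powerTrace 3) A = (3 : ℝ) • jordan F A A := by
  have hg : gradient (powerTrace 3 : HermitianTraceless 4 F → ℝ) A = (3 : ℝ) • jordan F A A := by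
    apply HasGradientAt.gradient
    rw [hasGradientAt_iff_hasFDerivAt]
    convert! hasFDerivAt_powerTrace_three A using 1
    rw [map_smul]
    rfl
  rw [sphereGrad, hg, Submodule.starProjection_eq_self_iff,
    Submodule.mem_orthogonal_singleton_iff_inner_left]
  rw [real_inner_smul_left (F := HermitianTraceless 4 F), hA, mul_zero]

theorem gradLength_eq {A : HermitianTraceless 4 F} (hA : inner ℝ (jordan F A A) A = 0) :
    gradLength F A = 3 * ‖jordan F A A‖ := by
  rw [gradLength, sphereGrad_powerTrace_three hA, norm_smul]
  norm_num

theorem unitGrad_eq {U : Set (HermitianTraceless 4 F)} {A : HermitianTraceless 4 F}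
    (hA : A ∈ cubicZeros (jordan F) U) :
    unitGrad F A = ‖jordan F A A‖⁻¹ • jordan F A A := by
  rw [unitGrad, gradLength_eq hA.2.2.1, sphereGrad_powerTrace_three hA.2.2.1, smul_smul]
  congr 1
  have := norm_ne_zero_iff.2 hA.2.2.2
  field_simp

end Gradient

/-! ### The dimension of `E(4, F)` -/

section Dimension

variable {F : Type} [NormedRing F] [StarRing F] [InnerProductSpace ℝ F] [IsHurwitz F]
  [StarModule ℝ F]

/-- The diagonal entries of Hermitian matrices are real. -/
theorem toMat_apply_self (A : HermitianTraceless 4 F) (i : Fin 4) :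
    toMat A i i = (inner ℝ 1 (toMat A i i) : ℝ) • (1 : F) :=
  IsHurwitz.eq_smul_one _ ((isHermitian_toMat A).apply i i)

variable (F) in
/-- A traceless Hermitian matrix is determined by the entries above the diagonal and three of the
diagonal entries. -/
def hermitianCoords :
    HermitianTraceless 4 F ≃ₗ[ℝ] ((F × F × F) × (F × F × F)) × (ℝ × ℝ × ℝ) where
  toFun A := (((toMat A 0 1, toMat A 0 2, toMat A 0 3), (toMat A 1 2, toMat A 1 3, toMat A 2 3)),
    (inner ℝ 1 (toMat A 0 0), inner ℝ 1 (toMat A 1 1), inner ℝ 1 (toMat A 2 2)))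
  map_add' A B := by simp [toMat_add, inner_add_right]
  map_smul' r A := by simp [toMat_smul, inner_smul_right]
  invFun p := ofMat
    !![p.2.1 • 1, p.1.1.1, p.1.1.2.1, p.1.1.2.2;
      star p.1.1.1, p.2.2.1 • 1, p.1.2.1, p.1.2.2.1;
      star p.1.1.2.1, star p.1.2.1, p.2.2.2 • 1, p.1.2.2.2;
      star p.1.1.2.2, star p.1.2.2.1, star p.1.2.2.2, (-(p.2.1 + p.2.2.1 + p.2.2.2)) • 1]
    (by
      ext i j
      fin_cases i <;> fin_cases j <;> simp [star_smul])
    (by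
      rw [realTrace, Matrix.trace]
      simp [Fin.sum_univ_four, add_smul])
  left_inv A := by
    apply toMat_injective
    refine (toMat_ofMat _ _ _).trans ?_
    have h := fun i j => (isHermitian_toMat A).apply i j
    have ht : toMat A 3 3 = -(toMat A 0 0 + toMat A 1 1 + toMat A 2 2) := by
      have := trace_toMat A
      rw [Matrix.trace, Fin.sum_univ_four] at this
      exact eq_neg_of_add_eq_zero_right this
    have h33 : (-(inner ℝ 1 (toMat A 2 2) : ℝ) + (-inner ℝ 1 (toMat A 1 1) +
        -inner ℝ 1 (toMat A 0 0))) • (1 : F) = toMat A 3 3 := by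
      rw [ht, add_smul, add_smul, neg_smul, neg_smul, neg_smul, ← toMat_apply_self,
        ← toMat_apply_self, ← toMat_apply_self]
      abel
    ext i j
    fin_cases i <;> fin_cases j <;>
      simp [h, ← toMat_apply_self, h33]
  right_inv p := by
    simp [toMat_ofMat, inner_smul_right, IsHurwitz.norm_one]

theorem finrank_hermitianTraceless [FiniteDimensional ℝ F] :
    Module.finrank ℝ (HermitianTraceless 4 F) = 6 * Module.finrank ℝ F + 3 := by
  rw [(hermitianCoords F).finrank_eq]
  simp only [Module.finrank_prod, Module.finrank_self]
  ring

end Dimension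

/-! ### The spectral theorem over `ℝ`, `ℂ`, `ℍ` -/

section Spectral

/-- A one-sided inverse over a finite-dimensional, possibly noncommutative, real algebra is
two-sided: left multiplication by it is an injective, hence surjective, real linear map. -/
theorem Matrix.mul_eq_one_of_mul_eq_one {n : ℕ} {F : Type} [Ring F] [Module ℝ F]
    [SMulCommClass ℝ F F] [FiniteDimensional ℝ F] {X Y : Matrix (Fin n) (Fin n) F} (h : X * Y = 1) :
    Y * X = 1 := by
  let f : Matrix (Fin n) (Fin n) F →ₗ[ℝ] Matrix (Fin n) (Fin n) F :=
    { toFun := fun Z => Y * Z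
      map_add' := mul_add Y
      map_smul' := fun r Z => Matrix.mul_smul Y r Z }
  have hf : Function.Injective f := fun Z Z' hZ => by
    have h1 : X * (Y * Z) = X * (Y * Z') := congrArg (X * ·) hZ
    rwa [← mul_assoc, ← mul_assoc, h, one_mul, one_mul] at h1
  obtain ⟨Z, hZ⟩ := LinearMap.injective_iff_surjective.1 hf 1
  have hZ' : Y * Z = 1 := hZ
  have : X = Z := by rw [← mul_one X, ← hZ', ← mul_assoc, h, one_mul]
  rw [this, hZ']

variable {n k : ℕ} {F : Type} [NormedRing F] [StarRing F]

/-- The `F`-valued Hermitian form on `Fⁿ`, which is conjugate-linear in the first variable. -/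
def hermForm (v w : PiLp 2 (fun _ : Fin n => F)) : F := ∑ i, star (v i) * w i

/-- The columns `s` form an orthonormal family for the Hermitian form. -/
def IsFrame (s : Fin k → PiLp 2 (fun _ : Fin n => F)) : Prop :=
  ∀ i j, hermForm (s i) (s j) = if i = j then 1 else 0

/-- The matrix whose columns are the given vectors. -/
def frameMatrix (s : Fin n → PiLp 2 (fun _ : Fin n => F)) : Matrix (Fin n) (Fin n) F :=
  Matrix.of fun i j => s j i

theorem star_hermForm (v w : PiLp 2 (fun _ : Fin n => F)) :
    star (hermForm v w) = hermForm w v := by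
  simp [hermForm, star_sum]

theorem IsFrame.comp_perm {s : Fin k → PiLp 2 (fun _ : Fin n => F)} (hs : IsFrame s)
    (σ : Equiv.Perm (Fin k)) : IsFrame (s ∘ σ) := fun i j => by
  simp [hs (σ i) (σ j)]

theorem IsFrame.snoc {s : Fin k → PiLp 2 (fun _ : Fin n => F)} (hs : IsFrame s)
    {w : PiLp 2 (fun _ : Fin n => F)} (hw : hermForm w w = 1) (hsw : ∀ i, hermForm (s i) w = 0) :
    IsFrame (Fin.snoc s w : Fin (k + 1) → PiLp 2 (fun _ : Fin n => F)) := by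
  have hws : ∀ i, hermForm w (s i) = 0 := fun i => by rw [← star_hermForm, hsw, star_zero]
  intro i j
  refine Fin.lastCases ?_ (fun i => ?_) i <;> refine Fin.lastCases ?_ (fun j => ?_) j
  · simp [hw]
  · simp [hws, (Fin.castSucc_lt_last j).ne']
  · simp [hsw, (Fin.castSucc_lt_last i).ne]
  · simp [hs i j]

variable [InnerProductSpace ℝ F] [IsHurwitz F]

theorem inner_one_hermForm (v w : PiLp 2 (fun _ : Fin n => F)) :
    inner ℝ 1 (hermForm v w) = inner ℝ v w := by
  simp only [hermForm, inner_sum, IsHurwitz.inner_one_star_mul, PiLp.inner_apply]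

/-- As a self-adjoint element of `F`, the value `⟨v, v⟩` is a real number. -/
theorem hermForm_self (v : PiLp 2 (fun _ : Fin n => F)) :
    hermForm v v = (‖v‖ ^ 2) • (1 : F) := by
  have h := IsHurwitz.eq_smul_one (hermForm v v) (star_hermForm v v)
  rwa [inner_one_hermForm, real_inner_self_eq_norm_sq] at h

/-- The Hermitian form as a real linear map in the second variable. -/
def hermFormRight (v : PiLp 2 (fun _ : Fin n => F)) : PiLp 2 (fun _ : Fin n => F) →ₗ[ℝ] F where
  toFun w := hermForm v w
  map_add' w w' := by simp [hermForm, mul_add, Finset.sum_add_distrib]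
  map_smul' r w := by simp [hermForm, mul_smul_comm, Finset.smul_sum]

theorem hermForm_smul_left [StarModule ℝ F] (r : ℝ) (v w : PiLp 2 (fun _ : Fin n => F)) :
    hermForm (r • v) w = r • hermForm v w := by
  simp [hermForm, star_smul, Finset.smul_sum, smul_mul_assoc]

/-- The orthogonal complement of a family of vectors for the Hermitian form. -/
def hermPerp (s : Fin k → PiLp 2 (fun _ : Fin n => F)) :
    Submodule ℝ (PiLp 2 (fun _ : Fin n => F)) :=
  LinearMap.ker (LinearMap.pi fun i => hermFormRight (s i))

theorem mem_hermPerp {s : Fin k → PiLp 2 (fun _ : Fin n => F)} {w : PiLp 2 (fun _ : Fin n => F)} :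
    w ∈ hermPerp s ↔ ∀ i, hermForm (s i) w = 0 := by
  rw [hermPerp, LinearMap.mem_ker, funext_iff]
  rfl

/-- The action of a matrix on columns, as a real linear map. -/
def matrixAct (X : Matrix (Fin n) (Fin n) F) :
    PiLp 2 (fun _ : Fin n => F) →ₗ[ℝ] PiLp 2 (fun _ : Fin n => F) where
  toFun v := WithLp.toLp 2 fun i => ∑ j, X i j * v j
  map_add' v w := by ext i; simp [mul_add, Finset.sum_add_distrib]
  map_smul' r v := by ext i; simp [mul_smul_comm, Finset.smul_sum]

theorem matrixAct_apply (X : Matrix (Fin n) (Fin n) F) (v : PiLp 2 (fun _ : Fin n => F))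
    (i : Fin n) : matrixAct X v i = ∑ j, X i j * v j := rfl

theorem hermForm_matrixAct {X : Matrix (Fin n) (Fin n) F} (hX : X.IsHermitian)
    (v w : PiLp 2 (fun _ : Fin n => F)) :
    hermForm v (matrixAct X w) = hermForm (matrixAct X v) w := by
  simp only [hermForm, matrixAct_apply, Finset.mul_sum, star_sum, star_mul, Finset.sum_mul]
  rw [Finset.sum_comm]
  refine Finset.sum_congr rfl fun i _ => Finset.sum_congr rfl fun j _ => ?_
  rw [← hX.apply j i, mul_assoc]

variable [FiniteDimensional ℝ F]

variable (F) in
theorem IsHurwitz.finrank_pos : 0 < Module.finrank ℝ F := by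
  have := IsHurwitz.nontrivial F
  exact Module.finrank_pos

/-- Each of the `k` orthogonality conditions cuts the real dimension by at most that of `F`. -/
theorem le_finrank_hermPerp (s : Fin k → PiLp 2 (fun _ : Fin n => F)) :
    n * Module.finrank ℝ F ≤ k * Module.finrank ℝ F + Module.finrank ℝ (hermPerp s) := by
  have h := LinearMap.finrank_range_add_finrank_ker (LinearMap.pi fun i => hermFormRight (s i))
  have h1 : Module.finrank ℝ (PiLp 2 (fun _ : Fin n => F)) = n * Module.finrank ℝ F := by
    rw [(WithLp.linearEquiv 2 ℝ (Fin n → F)).finrank_eq, Module.finrank_pi_fintype]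
    simp
  have h2 := Submodule.finrank_le (LinearMap.range (LinearMap.pi fun i => hermFormRight (s i)))
  rw [Module.finrank_pi_fintype, Finset.sum_const, Finset.card_univ, Fintype.card_fin,
    smul_eq_mul] at h2
  rw [h1] at h
  have h3 : Module.finrank ℝ (hermPerp s) =
      Module.finrank ℝ (LinearMap.ker (LinearMap.pi fun i => hermFormRight (s i))) := rfl
  omega

theorem exists_unit_mem_hermPerp (s : Fin k → PiLp 2 (fun _ : Fin n => F)) (hk : k < n) :
    ∃ w ∈ hermPerp s, ‖w‖ = 1 := by
  have h1 := le_finrank_hermPerp s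
  have h2 := IsHurwitz.finrank_pos F
  have h3 : 0 < Module.finrank ℝ (hermPerp s) := by nlinarith
  have : Nontrivial (hermPerp s) := Module.finrank_pos_iff.1 h3
  obtain ⟨w, hw⟩ := exists_norm_eq (hermPerp s) zero_le_one
  exact ⟨w, w.2, hw⟩

/-- The orthogonal complement of some eigenvectors contains a further eigenvector. -/
theorem exists_eigenvector_mem_hermPerp [StarModule ℝ F] {X : Matrix (Fin n) (Fin n) F}
    (hX : X.IsHermitian) {s : Fin k → PiLp 2 (fun _ : Fin n => F)} {μ : Fin k → ℝ}
    (hs : ∀ i, matrixAct X (s i) = μ i • s i) (hk : k < n) :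
    ∃ w ∈ hermPerp s, ‖w‖ = 1 ∧ ∃ ν : ℝ, matrixAct X w = ν • w := by
  have hinv : ∀ w ∈ hermPerp s, matrixAct X w ∈ hermPerp s := by
    intro w hw
    rw [mem_hermPerp] at hw ⊢
    intro i
    rw [hermForm_matrixAct hX, hs, hermForm_smul_left, hw, smul_zero]
  have hsym : (matrixAct X).IsSymmetric := by
    intro v w
    rw [← inner_one_hermForm, ← inner_one_hermForm, hermForm_matrixAct hX]
  have hsymr := hsym.restrict_invariant hinv
  obtain ⟨w₀, hw₀, hw₀1⟩ := exists_unit_mem_hermPerp s hk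
  have hne : ¬ Subsingleton (hermPerp s) := fun h => by
    have : (⟨w₀, hw₀⟩ : hermPerp s) = 0 := Subsingleton.elim _ _
    have h0 : w₀ = 0 := congrArg Subtype.val this
    rw [h0, norm_zero] at hw₀1
    exact zero_ne_one hw₀1
  have hex : ∃ ν : ℝ, Module.End.HasEigenvalue ((matrixAct X).restrict hinv) ν := by
    by_contra h
    push Not at h
    exact hne (hsymr.subsingleton_of_no_eigenvalue_finiteDimensional fun ν => by
      have := h ν
      rwa [Module.End.hasEigenvalue_iff, not_not] at this)
  obtain ⟨ν, hν⟩ := hex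
  obtain ⟨w, hw⟩ := hν.exists_hasEigenvector
  have hw0 : (w : PiLp 2 (fun _ : Fin n => F)) ≠ 0 := fun h => hw.2 (Subtype.ext h)
  have hXw : matrixAct X (w : PiLp 2 (fun _ : Fin n => F)) =
      ν • (w : PiLp 2 (fun _ : Fin n => F)) :=
    congrArg Subtype.val hw.apply_eq_smul
  refine ⟨‖(w : PiLp 2 (fun _ : Fin n => F))‖⁻¹ • (w : PiLp 2 (fun _ : Fin n => F)),
    Submodule.smul_mem _ _ w.2, ?_, ν, ?_⟩
  · rw [norm_smul, norm_inv, norm_norm, inv_mul_cancel₀ (norm_ne_zero_iff.2 hw0)]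
  · rw [map_smul, hXw, smul_comm]

/-- The spectral theorem: a Hermitian matrix over `F` has an orthonormal basis of eigenvectors with
real eigenvalues. -/
theorem exists_frame_eigenvectors [StarModule ℝ F] {X : Matrix (Fin n) (Fin n) F}
    (hX : X.IsHermitian) (hk : k ≤ n) :
    ∃ (s : Fin k → PiLp 2 (fun _ : Fin n => F)) (μ : Fin k → ℝ), IsFrame s ∧
      ∀ i, matrixAct X (s i) = μ i • s i := by
  induction k with
  | zero => exact ⟨Fin.elim0, Fin.elim0, fun i => i.elim0, fun i => i.elim0⟩
  | succ k ih =>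
    obtain ⟨s, μ, hs, hμ⟩ := ih (by omega)
    obtain ⟨w, hw, hw1, ν, hν⟩ := exists_eigenvector_mem_hermPerp hX hμ (by omega)
    refine ⟨Fin.snoc s w, Fin.snoc μ ν, hs.snoc (by rw [hermForm_self, hw1]; simp)
      (mem_hermPerp.1 hw), fun i => ?_⟩
    refine Fin.lastCases ?_ (fun i => ?_) i
    · simp [hν]
    · simp [hμ i]

theorem IsFrame.frameMatrix_mem_unitary {s : Fin n → PiLp 2 (fun _ : Fin n => F)}
    (hs : IsFrame s) : frameMatrix s ∈ unitary (Matrix (Fin n) (Fin n) F) := by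
  have h : star (frameMatrix s) * frameMatrix s = 1 := by
    ext i j
    rw [Matrix.mul_apply, Matrix.one_apply, ← hs i j]
    rfl
  exact Unitary.mem_iff.2 ⟨h, Matrix.mul_eq_one_of_mul_eq_one h⟩

/-- The diagonal matrix with the given real entries. -/
def realDiagonal (a : Fin n → ℝ) : Matrix (Fin n) (Fin n) F :=
  Matrix.diagonal fun i => a i • (1 : F)

theorem IsFrame.eq_mul_realDiagonal_mul {X : Matrix (Fin n) (Fin n) F}
    {s : Fin n → PiLp 2 (fun _ : Fin n => F)} (hs : IsFrame s) {μ : Fin n → ℝ}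
    (hμ : ∀ i, matrixAct X (s i) = μ i • s i) :
    X = frameMatrix s * realDiagonal μ * star (frameMatrix s) := by
  have h : X * frameMatrix s = frameMatrix s * realDiagonal μ := by
    ext i j
    have h1 := congrArg (fun v : PiLp 2 (fun _ : Fin n => F) => v i) (hμ j)
    rw [Matrix.mul_apply, realDiagonal, Matrix.mul_diagonal, mul_smul_comm, mul_one]
    exact h1
  rw [← h, mul_assoc, (Unitary.mem_iff.1 hs.frameMatrix_mem_unitary).2, mul_one]

end Spectral

/-! ### Four numbers with vanishing sum and sum of cubes -/

section Eigenvalues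

/-- Four real numbers whose sum and sum of cubes vanish are `a, -a, b, -b` in some order. -/
theorem exists_perm_eq_of_sum_eq_zero (μ : Fin 4 → ℝ) (h1 : ∑ i, μ i = 0)
    (h3 : ∑ i, μ i ^ 3 = 0) :
    ∃ (σ : Equiv.Perm (Fin 4)) (a b : ℝ), μ ∘ σ = ![a, -a, b, -b] ∧ 0 ≤ b ∧ b ≤ a := by
  -- the conclusion is invariant under permutations
  have hperm : ∀ (ν : Fin 4 → ℝ) (τ : Equiv.Perm (Fin 4)),
      (∃ (σ : Equiv.Perm (Fin 4)) (a b : ℝ), (ν ∘ τ) ∘ σ = ![a, -a, b, -b] ∧ 0 ≤ b ∧ b ≤ a) →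
      ∃ (σ : Equiv.Perm (Fin 4)) (a b : ℝ), ν ∘ σ = ![a, -a, b, -b] ∧ 0 ≤ b ∧ b ≤ a := by
    rintro ν τ ⟨σ, a, b, h, h'⟩
    exact ⟨σ.trans τ, a, b, h, h'⟩
  have of_nonneg : ∀ a b : ℝ, 0 ≤ a → 0 ≤ b →
      ∃ (σ : Equiv.Perm (Fin 4)) (a' b' : ℝ),
        ![a, -a, b, -b] ∘ σ = ![a', -a', b', -b'] ∧ 0 ≤ b' ∧ b' ≤ a' := by
    intro a b ha hb
    rcases le_total b a with h | h
    · exact ⟨Equiv.refl _, a, b, rfl, hb, h⟩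
    · refine ⟨(Equiv.swap 0 2).trans (Equiv.swap 1 3), b, a, ?_, ha, h⟩
      ext i
      fin_cases i <;> rfl
  have of_fst_nonneg : ∀ a b : ℝ, 0 ≤ a →
      ∃ (σ : Equiv.Perm (Fin 4)) (a' b' : ℝ),
        ![a, -a, b, -b] ∘ σ = ![a', -a', b', -b'] ∧ 0 ≤ b' ∧ b' ≤ a' := by
    intro a b ha
    rcases le_total 0 b with h | h
    · exact of_nonneg a b ha h
    · refine hperm _ (Equiv.swap 2 3) ?_
      have e : ![a, -a, b, -b] ∘ Equiv.swap 2 3 = ![a, -a, -b, -(-b)] := by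
        ext i
        fin_cases i <;> simp [Equiv.swap_apply_def]
      rw [e]
      exact of_nonneg a (-b) ha (by linarith)
  have of_pairs : ∀ a b : ℝ,
      ∃ (σ : Equiv.Perm (Fin 4)) (a' b' : ℝ),
        ![a, -a, b, -b] ∘ σ = ![a', -a', b', -b'] ∧ 0 ≤ b' ∧ b' ≤ a' := by
    intro a b
    rcases le_total 0 a with h | h
    · exact of_fst_nonneg a b h
    · refine hperm _ (Equiv.swap 0 1) ?_
      have e : ![a, -a, b, -b] ∘ Equiv.swap 0 1 = ![-a, -(-a), b, -b] := by
        ext i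
        fin_cases i <;> simp [Equiv.swap_apply_def]
      rw [e]
      exact of_fst_nonneg (-a) b (by linarith)
  have of_add_eq_zero : ∀ ν : Fin 4 → ℝ, ν 0 + ν 1 + ν 2 + ν 3 = 0 → ν 0 + ν 1 = 0 →
      ∃ (σ : Equiv.Perm (Fin 4)) (a' b' : ℝ),
        ν ∘ σ = ![a', -a', b', -b'] ∧ 0 ≤ b' ∧ b' ≤ a' := by
    intro ν h h'
    have e : ν = ![ν 0, -ν 0, ν 2, -ν 2] := by
      ext i
      fin_cases i <;> simp <;> linarith
    rw [e]
    exact of_pairs _ _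
  rw [Fin.sum_univ_four] at h1 h3
  -- if `∑ μ i = 0` then `∑ μ i ^ 3 = 3 (μ 0 + μ 1) (μ 0 + μ 2) (μ 0 + μ 3)`
  have hprod : (μ 0 + μ 1) * ((μ 0 + μ 2) * (μ 0 + μ 3)) = 0 := by
    have e : μ 3 = -(μ 0 + μ 1 + μ 2) := by linarith
    rw [e] at h3 ⊢
    linear_combination h3 / 3
  rcases mul_eq_zero.1 hprod with h | h
  · exact of_add_eq_zero μ h1 h
  rcases mul_eq_zero.1 h with h | h
  · refine hperm μ (Equiv.swap 1 2) (of_add_eq_zero _ ?_ ?_) <;>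
      simp [Equiv.swap_apply_def] <;> linarith
  · refine hperm μ (Equiv.swap 1 3) (of_add_eq_zero _ ?_ ?_) <;>
      simp [Equiv.swap_apply_def] <;> linarith

end Eigenvalues

/-! ### Unitary conjugation, diagonal and off-diagonal matrices -/

section Conj

/-- Conjugation by a unitary element is multiplicative. -/
theorem unitary_mul_cancel {R : Type*} [Monoid R] [StarMul R] (P : unitary R) (X Y : R) :
    (star (P : R) * X * P) * (star (P : R) * Y * P) = star (P : R) * (X * Y) * P := by
  have h := Unitary.mul_star_self_of_mem P.2
  calc _ = star (P : R) * X * ((P : R) * star (P : R)) * (Y * P) := by simp only [mul_assoc]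
    _ = _ := by rw [h, mul_one]; simp only [mul_assoc]

theorem isHermitian_realDiagonal {n : ℕ} {F : Type} [NormedRing F] [StarRing F]
    [InnerProductSpace ℝ F] [StarModule ℝ F] (a : Fin n → ℝ) :
    (realDiagonal a : Matrix (Fin n) (Fin n) F).IsHermitian := by
  rw [realDiagonal, Matrix.IsHermitian, Matrix.diagonal_conjTranspose]
  congr 1
  ext i
  simp [star_smul]

variable {F : Type} [NormedRing F] [StarRing F] [InnerProductSpace ℝ F] [IsHurwitz F]

theorem realTrace_realDiagonal {n : ℕ} (a : Fin n → ℝ) :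
    realTrace (realDiagonal a : Matrix (Fin n) (Fin n) F) = ∑ i, a i := by
  rw [realTrace, realDiagonal, Matrix.trace_diagonal, inner_sum]
  simp [inner_smul_right, IsHurwitz.norm_one]

theorem realDiagonal_mul {n : ℕ} (a b : Fin n → ℝ) :
    (realDiagonal a * realDiagonal b : Matrix (Fin n) (Fin n) F) = realDiagonal (a * b) := by
  simp only [realDiagonal, Matrix.diagonal_mul_diagonal, smul_mul_smul_comm, mul_one, Pi.mul_apply]

theorem realDiagonal_mul_single {n : ℕ} (a : Fin n → ℝ) (i j : Fin n) (q : F) :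
    (realDiagonal a * Matrix.single i j q : Matrix (Fin n) (Fin n) F) =
      a i • Matrix.single i j q := by
  ext k l
  rw [realDiagonal, Matrix.diagonal_mul, Matrix.smul_apply, smul_mul_assoc, one_mul]
  by_cases h : i = k
  · rw [h]
  · rw [Matrix.single_apply_of_row_ne h, smul_zero, smul_zero]

theorem single_mul_realDiagonal {n : ℕ} (a : Fin n → ℝ) (i j : Fin n) (q : F) :
    (Matrix.single i j q * realDiagonal a : Matrix (Fin n) (Fin n) F) =
      a j • Matrix.single i j q := by
  ext k l
  rw [realDiagonal, Matrix.mul_diagonal, Matrix.smul_apply, mul_smul_comm, mul_one]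
  by_cases h : j = l
  · rw [h]
  · rw [Matrix.single_apply_of_col_ne _ _ h, smul_zero, smul_zero]

variable [StarModule ℝ F]

/-- The matrix `P* A P`, which is Hermitian and traceless if `A` is. -/
def unitaryConjFun (P : unitary (Matrix (Fin 4) (Fin 4) F)) (A : HermitianTraceless 4 F) :
    HermitianTraceless 4 F :=
  ofMat (star (P : Matrix (Fin 4) (Fin 4) F) * toMat A * P)
    (by
      rw [Matrix.star_eq_conjTranspose]
      exact Matrix.isHermitian_conjTranspose_mul_mul _ (isHermitian_toMat A))
    (by
      rw [realTrace_mul_comm, ← mul_assoc, Unitary.mul_star_self_of_mem P.2, one_mul,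
        realTrace_toMat])

theorem toMat_unitaryConjFun (P : unitary (Matrix (Fin 4) (Fin 4) F))
    (A : HermitianTraceless 4 F) :
    toMat (unitaryConjFun P A) =
      star (P : Matrix (Fin 4) (Fin 4) F) * toMat A * (P : Matrix (Fin 4) (Fin 4) F) := rfl

theorem unitaryConjFun_unitaryConjFun (P Q : unitary (Matrix (Fin 4) (Fin 4) F))
    (A : HermitianTraceless 4 F) :
    unitaryConjFun Q (unitaryConjFun P A) = unitaryConjFun (P * Q) A := by
  apply toMat_injective
  simp only [toMat_unitaryConjFun, Submonoid.coe_mul, star_mul, mul_assoc]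

theorem unitaryConjFun_one (A : HermitianTraceless 4 F) : unitaryConjFun 1 A = A := by
  apply toMat_injective
  simp only [toMat_unitaryConjFun, OneMemClass.coe_one, star_one, mul_one, one_mul]

theorem inner_unitaryConjFun (P : unitary (Matrix (Fin 4) (Fin 4) F))
    (A B : HermitianTraceless 4 F) :
    inner ℝ (unitaryConjFun P A) (unitaryConjFun P B) = inner ℝ A B := by
  rw [inner_eq_realTrace, inner_eq_realTrace, toMat_unitaryConjFun, toMat_unitaryConjFun,
    unitary_mul_cancel, realTrace_mul_comm, ← mul_assoc, Unitary.mul_star_self_of_mem P.2, one_mul]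

/-- Conjugation by a unitary matrix, as a linear equivalence. -/
def unitaryConjLin (P : unitary (Matrix (Fin 4) (Fin 4) F)) :
    HermitianTraceless 4 F ≃ₗ[ℝ] HermitianTraceless 4 F where
  toFun := unitaryConjFun P
  map_add' A B := toMat_injective (by
    simp only [toMat_unitaryConjFun, toMat_add, mul_add, add_mul])
  map_smul' r A := toMat_injective (by
    simp only [toMat_unitaryConjFun, toMat_smul, Matrix.mul_smul, Matrix.smul_mul,
      RingHom.id_apply])
  invFun := unitaryConjFun P⁻¹
  left_inv A := by
    rw [unitaryConjFun_unitaryConjFun, mul_inv_cancel, unitaryConjFun_one]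
  right_inv A := by
    rw [unitaryConjFun_unitaryConjFun, inv_mul_cancel, unitaryConjFun_one]

/-- The isometry `A ↦ P* A P` of `E(4, F)`. -/
def unitaryConj (P : unitary (Matrix (Fin 4) (Fin 4) F)) :
    HermitianTraceless 4 F ≃ₗᵢ[ℝ] HermitianTraceless 4 F :=
  LinearEquiv.isometryOfInner (𝕜 := ℝ) (E := HermitianTraceless 4 F)
    (E' := HermitianTraceless 4 F)
    (unitaryConjLin P) (inner_unitaryConjFun P)

theorem toMat_unitaryConj (P : unitary (Matrix (Fin 4) (Fin 4) F)) (A : HermitianTraceless 4 F) :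
    toMat (unitaryConj P A) =
      star (P : Matrix (Fin 4) (Fin 4) F) * toMat A * (P : Matrix (Fin 4) (Fin 4) F) := rfl

theorem inner_unitaryConj (P : unitary (Matrix (Fin 4) (Fin 4) F)) (A B : HermitianTraceless 4 F) :
    inner ℝ (unitaryConj P A) (unitaryConj P B) = inner ℝ A B :=
  inner_unitaryConjFun P A B

section Jordan

variable [FiniteDimensional ℝ F]

theorem jordan_unitaryConj (P : unitary (Matrix (Fin 4) (Fin 4) F))
    (A B : HermitianTraceless 4 F) :
    jordan F (unitaryConj P A) (unitaryConj P B) = unitaryConj P (jordan F A B) := by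
  apply toMat_injective
  rw [toMat_unitaryConj, toMat_jordan, toMat_jordan, inner_unitaryConj, toMat_unitaryConj,
    toMat_unitaryConj, unitary_mul_cancel, unitary_mul_cancel]
  simp only [mul_add, add_mul, mul_sub, sub_mul, Matrix.mul_smul, Matrix.smul_mul, mul_one,
    Unitary.star_mul_self_of_mem P.2]

theorem jordan_unitaryConj_symm (P : unitary (Matrix (Fin 4) (Fin 4) F))
    (A B : HermitianTraceless 4 F) :
    jordan F ((unitaryConj P).symm A) ((unitaryConj P).symm B) =
      (unitaryConj P).symm (jordan F A B) := by
  apply (unitaryConj P).injective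
  rw [← jordan_unitaryConj]
  simp

end Jordan

variable (F) in
/-- A traceless real diagonal matrix. -/
def diagElt (a : Fin 4 → ℝ) (ha : ∑ i, a i = 0) : HermitianTraceless 4 F :=
  ofMat (realDiagonal a) (isHermitian_realDiagonal a) (by rw [realTrace_realDiagonal, ha])

theorem toMat_diagElt (a : Fin 4 → ℝ) (ha : ∑ i, a i = 0) :
    toMat (diagElt F a ha) = realDiagonal a := rfl

theorem diagElt_congr {a b : Fin 4 → ℝ} (h : a = b) (ha : ∑ i, a i = 0) :
    diagElt F a ha = diagElt F b (h ▸ ha) := by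
  subst h; rfl

theorem inner_diagElt (a b : Fin 4 → ℝ) (ha : ∑ i, a i = 0) (hb : ∑ i, b i = 0) :
    inner ℝ (diagElt F a ha) (diagElt F b hb) = ∑ i, a i * b i := by
  rw [inner_eq_realTrace, toMat_diagElt, toMat_diagElt, realDiagonal_mul, realTrace_realDiagonal]
  rfl

theorem smul_diagElt (r : ℝ) (a : Fin 4 → ℝ) (ha : ∑ i, a i = 0) :
    r • diagElt F a ha = diagElt F (r • a) (by simp [← Finset.mul_sum, ha]) := by
  apply toMat_injective
  rw [toMat_smul, toMat_diagElt, toMat_diagElt, realDiagonal, realDiagonal, ← Matrix.diagonal_smul]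
  congr 1
  ext i
  simp [smul_smul]

variable (F) in
/-- The Hermitian matrix with the entry `q` at the place `(i, j)` off the diagonal. -/
def offDiag (i j : Fin 4) (hij : i ≠ j) : F →ₗ[ℝ] HermitianTraceless 4 F where
  toFun q := ofMat (Matrix.single i j q + Matrix.single j i (star q))
    (by
      rw [Matrix.IsHermitian, Matrix.conjTranspose_add, Matrix.conjTranspose_single,
        Matrix.conjTranspose_single, star_star, add_comm])
    (by
      rw [realTrace, Matrix.trace_add, Matrix.trace_single_eq_of_ne i j _ hij,
        Matrix.trace_single_eq_of_ne j i _ hij.symm, add_zero, inner_zero_right])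
  map_add' q r := toMat_injective (by
    simp only [toMat_ofMat, toMat_add, star_add, Matrix.single_add]
    abel)
  map_smul' t q := toMat_injective (by
    simp only [toMat_ofMat, toMat_smul, star_smul, star_trivial, Matrix.smul_single, smul_add,
      RingHom.id_apply])

theorem toMat_offDiag (i j : Fin 4) (hij : i ≠ j) (q : F) :
    toMat (offDiag F i j hij q) = Matrix.single i j q + Matrix.single j i (star q) := rfl

theorem inner_diagElt_offDiag (a : Fin 4 → ℝ) (ha : ∑ i, a i = 0) (i j : Fin 4) (hij : i ≠ j)
    (q : F) : inner ℝ (diagElt F a ha) (offDiag F i j hij q) = 0 := by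
  rw [inner_eq_realTrace, toMat_diagElt, toMat_offDiag, realTrace, Matrix.trace]
  simp only [Matrix.diag, realDiagonal, Matrix.diagonal_mul, Matrix.add_apply]
  rw [Finset.sum_eq_zero, inner_zero_right]
  intro k _
  rw [Matrix.single_apply_of_ne, Matrix.single_apply_of_ne]
  · simp
  · rintro ⟨rfl, rfl⟩; exact hij rfl
  · rintro ⟨rfl, rfl⟩; exact hij rfl

variable [FiniteDimensional ℝ F]

theorem jordan_diagElt (a b : Fin 4 → ℝ) (ha : ∑ i, a i = 0) (hb : ∑ i, b i = 0) :
    jordan F (diagElt F a ha) (diagElt F b hb) =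
      diagElt F (fun i => a i * b i - (∑ j, a j * b j) / 4) (by
        rw [Finset.sum_sub_distrib]; simp; ring) := by
  apply toMat_injective
  rw [toMat_jordan, toMat_diagElt, toMat_diagElt, toMat_diagElt, inner_diagElt, realDiagonal_mul,
    realDiagonal_mul, mul_comm b a, ← two_smul ℝ, smul_smul]
  ext i j
  by_cases h : i = j
  · subst h
    simp [realDiagonal, sub_smul]
  · simp [realDiagonal, h]

/-- Off-diagonal matrices are eigenvectors of the Jordan product with a diagonal matrix. -/
theorem jordan_diagElt_offDiag (a : Fin 4 → ℝ) (ha : ∑ i, a i = 0) (i j : Fin 4) (hij : i ≠ j)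
    (q : F) : jordan F (diagElt F a ha) (offDiag F i j hij q) =
      ((a i + a j) / 2) • offDiag F i j hij q := by
  apply toMat_injective
  rw [toMat_jordan, inner_diagElt_offDiag, toMat_smul, toMat_diagElt, toMat_offDiag, mul_add,
    add_mul]
  simp only [realDiagonal_mul_single, single_mul_realDiagonal]
  module

end Conj

/-! ### Normal form of the regular zeros -/

section NormalForm

theorem coe_star_unitary {R : Type*} [Monoid R] [StarMul R] (P : unitary R) :
    ((star P : unitary R) : R) = star (P : R) := rfl

variable {F : Type} [NormedRing F] [StarRing F] [InnerProductSpace ℝ F] [IsHurwitz F]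
  [StarModule ℝ F]

theorem sum_signPairs (a b : ℝ) : ∑ i, (![a, -a, b, -b] : Fin 4 → ℝ) i = 0 := by
  simp [Fin.sum_univ_four]

variable (F) in
/-- The matrix `diag(a, -a, b, -b)`. -/
def signPairs (a b : ℝ) : HermitianTraceless 4 F := diagElt F ![a, -a, b, -b] (sum_signPairs a b)

theorem inner_signPairs (a b c d : ℝ) :
    inner ℝ (signPairs F a b) (signPairs F c d) = 2 * (a * c + b * d) := by
  rw [signPairs, signPairs, inner_diagElt]
  simp [Fin.sum_univ_four]
  ring

/-- The matrix `diag(r, r, -r, -r)`, which is normal to the hypersurface at the matrices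
`diag(a, -a, b, -b)`. -/
def blockSigns (F : Type) [NormedRing F] [StarRing F] [InnerProductSpace ℝ F] [IsHurwitz F]
    [StarModule ℝ F] (r : ℝ) : HermitianTraceless 4 F :=
  diagElt F ![r, r, -r, -r] (by simp [Fin.sum_univ_four])

theorem inner_signPairs_blockSigns (a b r : ℝ) :
    inner ℝ (signPairs F a b) (blockSigns F r) = 0 := by
  rw [signPairs, blockSigns, inner_diagElt]
  simp [Fin.sum_univ_four]

theorem norm_blockSigns (r : ℝ) : ‖blockSigns F r‖ = 2 * |r| := by
  refine (pow_left_inj₀ (norm_nonneg _) (by positivity) two_ne_zero).1 ?_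
  rw [← real_inner_self_eq_norm_sq (F := HermitianTraceless 4 F), blockSigns, inner_diagElt,
    mul_pow, sq_abs]
  simp [Fin.sum_univ_four]
  ring

theorem smul_blockSigns (r s : ℝ) : r • blockSigns F s = blockSigns F (r * s) := by
  rw [blockSigns, smul_diagElt]
  apply diagElt_congr
  ext i
  fin_cases i <;> simp

theorem isUnit_unitaryConj_signPairs (P : unitary (Matrix (Fin 4) (Fin 4) F)) {a b : ℝ}
    (hb : 0 ≤ b) (hba : b < a) :
    IsUnit (toMat (unitaryConj P (signPairs F a b))) ↔ b ≠ 0 := by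
  have hP : IsUnit (P : Matrix (Fin 4) (Fin 4) F) :=
    ⟨Unitary.toUnits P, rfl⟩
  have hP' : IsUnit (star (P : Matrix (Fin 4) (Fin 4) F)) := hP.star
  have h1 : IsUnit (toMat (unitaryConj P (signPairs F a b))) ↔
      IsUnit (realDiagonal ![a, -a, b, -b] : Matrix (Fin 4) (Fin 4) F) := by
    rw [toMat_unitaryConj, signPairs, toMat_diagElt, mul_assoc]
    constructor
    · intro h
      have h' := hP.mul (h.mul hP')
      rwa [mul_assoc, mul_assoc, Unitary.mul_star_self_of_mem P.2, mul_one, ← mul_assoc,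
        Unitary.mul_star_self_of_mem P.2, one_mul] at h'
    · exact fun h => hP'.mul (h.mul hP)
  rw [h1]
  constructor
  · rintro h rfl
    have hz : (realDiagonal ![a, -a, 0, -0] : Matrix (Fin 4) (Fin 4) F) *
        Matrix.single 2 2 1 = 0 := by
      rw [realDiagonal_mul_single]
      simp
    have h2 := (h.mul_right_eq_zero).1 hz
    have h3 : (1 : F) = 0 := by simpa using congrFun (congrFun h2 2) 2
    have := IsHurwitz.nontrivial F
    exact one_ne_zero h3
  · intro h
    have ha : a ≠ 0 := by
      rintro rfl
      linarith
    have hmul : (![a, -a, b, -b] * ![a⁻¹, -a⁻¹, b⁻¹, -b⁻¹] : Fin 4 → ℝ) = 1 := by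
      ext i
      fin_cases i <;> simp [ha, h]
    have hone : (realDiagonal (1 : Fin 4 → ℝ) : Matrix (Fin 4) (Fin 4) F) = 1 := by
      simp [realDiagonal]
    refine ⟨⟨realDiagonal ![a, -a, b, -b], realDiagonal ![a⁻¹, -a⁻¹, b⁻¹, -b⁻¹], ?_, ?_⟩, rfl⟩
    · rw [realDiagonal_mul, hmul, hone]
    · rw [realDiagonal_mul, mul_comm, hmul, hone]

variable [FiniteDimensional ℝ F]

theorem jordan_signPairs (a b c d : ℝ) :
    jordan F (signPairs F a b) (signPairs F c d) = blockSigns F ((a * c - b * d) / 2) := by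
  rw [signPairs, signPairs, jordan_diagElt]
  apply diagElt_congr
  ext i
  fin_cases i <;> simp [Fin.sum_univ_four] <;> ring

theorem jordan_signPairs_blockSigns (a b r : ℝ) :
    jordan F (signPairs F a b) (blockSigns F r) = signPairs F (a * r) (-(b * r)) := by
  rw [signPairs, blockSigns, jordan_diagElt]
  apply diagElt_congr
  ext i
  fin_cases i <;> simp [Fin.sum_univ_four]

theorem unitaryConj_signPairs_mem_cubicZeros (P : unitary (Matrix (Fin 4) (Fin 4) F)) {a b : ℝ}
    (h : a ^ 2 + b ^ 2 = 1 / 2) (hb : 0 ≤ b) (hba : b < a) :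
    unitaryConj P (signPairs F a b) ∈ cubicZeros (jordan F) Set.univ := by
  refine ⟨trivial, ?_, ?_, ?_⟩
  · rw [LinearIsometryEquiv.norm_map, norm_eq_sqrt_real_inner (F := HermitianTraceless 4 F),
      inner_signPairs, Real.sqrt_eq_one]
    linarith
  · rw [jordan_unitaryConj, inner_unitaryConj, jordan_signPairs, real_inner_comm,
      inner_signPairs_blockSigns]
  · rw [jordan_unitaryConj, ← norm_ne_zero_iff, LinearIsometryEquiv.norm_map, jordan_signPairs,
      norm_blockSigns]
    have : 0 < (a * a - b * b) / 2 := by nlinarith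
    positivity

/-- The gradient of the cubic form at a matrix with the eigenvalues `a, -a, b, -b` has length
`3 (a ^ 2 - b ^ 2)`. -/
theorem norm_jordan_unitaryConj_signPairs (P : unitary (Matrix (Fin 4) (Fin 4) F)) {a b : ℝ}
    (hb : 0 ≤ b) (hba : b ≤ a) :
    ‖jordan F (unitaryConj P (signPairs F a b)) (unitaryConj P (signPairs F a b))‖ =
      a ^ 2 - b ^ 2 := by
  rw [jordan_unitaryConj, LinearIsometryEquiv.norm_map, jordan_signPairs, norm_blockSigns,
    abs_of_nonneg (by nlinarith)]
  ring

/-- The spectral theorem for the zeros of the cubic form: as the trace and the trace of the cube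
vanish, the eigenvalues are `l₁, -l₁, l₂, -l₂`. -/
theorem exists_eq_unitaryConj_signPairs {A : HermitianTraceless 4 F}
    (hA : A ∈ cubicZeros (jordan F) Set.univ) :
    ∃ (P : unitary (Matrix (Fin 4) (Fin 4) F)) (l₁ l₂ : ℝ),
      l₁ ^ 2 + l₂ ^ 2 = 1 / 2 ∧ 0 ≤ l₂ ∧ l₂ < l₁ ∧ A = unitaryConj P (signPairs F l₁ l₂) := by
  obtain ⟨-, h1, h2, h3⟩ := hA
  obtain ⟨s, μ, hs, hμ⟩ := exists_frame_eigenvectors (isHermitian_toMat A) le_rfl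
  -- the diagonalization is needed for two orders of the eigenvalues
  have key : ∀ (t : Fin 4 → PiLp 2 (fun _ : Fin 4 => F)) (ν : Fin 4 → ℝ) (ht : IsFrame t)
      (hν : ∀ i, matrixAct (toMat A) (t i) = ν i • t i),
      ∃ (P : unitary (Matrix (Fin 4) (Fin 4) F)) (h0 : ∑ i, ν i = 0),
        A = unitaryConj P (diagElt F ν h0) := by
    intro t ν ht hν
    have e := ht.eq_mul_realDiagonal_mul hν
    let P : unitary (Matrix (Fin 4) (Fin 4) F) := star ⟨frameMatrix t, ht.frameMatrix_mem_unitary⟩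
    have h0 : ∑ i, ν i = 0 := by
      rw [← realTrace_realDiagonal (F := F), ← realTrace_toMat A, e, realTrace_mul_comm,
        ← mul_assoc, (Unitary.mem_iff.1 ht.frameMatrix_mem_unitary).1, one_mul]
    refine ⟨P, h0, toMat_injective ?_⟩
    rw [toMat_unitaryConj, toMat_diagElt, coe_star_unitary, star_star]
    exact e
  obtain ⟨P, h0, hP⟩ := key s μ hs hμ
  have hcube : ∑ i, μ i ^ 3 = 0 := by
    rw [hP, jordan_unitaryConj, inner_unitaryConj, jordan_diagElt, inner_diagElt] at h2
    simp only [sub_mul, Finset.sum_sub_distrib, ← Finset.mul_sum, h0, mul_zero, sub_zero] at h2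
    rw [← h2]
    exact Finset.sum_congr rfl fun i _ => by ring
  obtain ⟨σ, a, b, hσ, hb, hba⟩ := exists_perm_eq_of_sum_eq_zero μ h0 hcube
  obtain ⟨Q, h0', hQ⟩ := key (s ∘ σ) (μ ∘ σ) (hs.comp_perm σ) fun i => hμ (σ i)
  have hQ' : A = unitaryConj Q (signPairs F a b) := by
    rw [hQ, signPairs]
    congr 1
    exact diagElt_congr hσ h0'
  have hnorm : inner ℝ A A = (1 : ℝ) := by
    rw [real_inner_self_eq_norm_sq (F := HermitianTraceless 4 F), h1, one_pow]
  rw [hQ', inner_unitaryConj, inner_signPairs] at hnorm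
  refine ⟨Q, a, b, by linarith, hb, lt_of_le_of_ne hba fun h => h3 ?_, hQ'⟩
  rw [← norm_eq_zero, hQ', norm_jordan_unitaryConj_signPairs Q hb hba, h, sub_self]

variable (F) in
/-- The matrices `A` for which the traceless part of `A ^ 2` has norm less than `1 / 2`. -/
def smallJordan : Set (HermitianTraceless 4 F) := {A | ‖jordan F A A‖ < 1 / 2}

variable (F) in
theorem continuous_norm_jordan_self :
    Continuous fun A : HermitianTraceless 4 F => ‖jordan F A A‖ :=
  Continuous.comp (X := HermitianTraceless 4 F) (Y := HermitianTraceless 4 F) (g := norm)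
    continuous_norm
    (IsCubicProduct.contDiff_self (V := HermitianTraceless 4 F) (B := jordan F)).continuous

variable (F) in
theorem isOpen_smallJordan : IsOpen (smallJordan F) :=
  (continuous_norm_jordan_self F).isOpen_preimage _ isOpen_Iio

theorem exists_eq_unitaryConj_signPairs_pos {A : HermitianTraceless 4 F}
    (hA : A ∈ cubicZeros (jordan F) (smallJordan F)) :
    ∃ (P : unitary (Matrix (Fin 4) (Fin 4) F)) (l₁ l₂ : ℝ),
      l₁ ^ 2 + l₂ ^ 2 = 1 / 2 ∧ 0 < l₂ ∧ l₂ < l₁ ∧ A = unitaryConj P (signPairs F l₁ l₂) := by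
  obtain ⟨P, a, b, h1, hb, hba, h⟩ := exists_eq_unitaryConj_signPairs ⟨trivial, hA.2⟩
  refine ⟨P, a, b, h1, lt_of_le_of_ne hb ?_, hba, h⟩
  rintro rfl
  have h2 : ‖jordan F A A‖ < 1 / 2 := hA.1
  rw [h, norm_jordan_unitaryConj_signPairs P le_rfl hba.le] at h2
  linarith

theorem unitaryConj_signPairs_mem (P : unitary (Matrix (Fin 4) (Fin 4) F)) {a b : ℝ}
    (h : a ^ 2 + b ^ 2 = 1 / 2) (hb : 0 < b) (hba : b < a) :
    unitaryConj P (signPairs F a b) ∈ cubicZeros (jordan F) (smallJordan F) := by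
  refine ⟨?_, (unitaryConj_signPairs_mem_cubicZeros P h hb.le hba).2⟩
  change ‖_‖ < _
  rw [norm_jordan_unitaryConj_signPairs P hb.le hba.le]
  nlinarith

/-- The regular zeros have the eigenvalues `a, -a, b, -b` with `a ^ 2 + b ^ 2 = 1 / 2`, and the
traceless part of the square has norm `a ^ 2 - b ^ 2`. This is less than `1 / 2` if and only if
`b ≠ 0`. -/
theorem invertibleRegularZeros_eq :
    invertibleRegularZeros 4 F = cubicZeros (jordan F) (smallJordan F) := by
  ext A
  constructor
  · rintro ⟨h1, h2⟩
    rw [regularZeros_eq] at h1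
    obtain ⟨P, a, b, h, hb, hba, rfl⟩ := exists_eq_unitaryConj_signPairs h1
    rw [isUnit_unitaryConj_signPairs P hb hba] at h2
    exact unitaryConj_signPairs_mem P h (lt_of_le_of_ne hb h2.symm) hba
  · intro hA
    obtain ⟨P, a, b, h, hb, hba, rfl⟩ := exists_eq_unitaryConj_signPairs_pos hA
    refine ⟨?_, (isUnit_unitaryConj_signPairs P hb.le hba).2 hb.ne'⟩
    rw [regularZeros_eq]
    exact ⟨trivial, hA.2⟩

/-- The permutation matrix which swaps the first coordinate with the second and the third with the
fourth conjugates `diag(a, -a, b, -b)` to its negative. -/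
theorem exists_isometry_neg (P : unitary (Matrix (Fin 4) (Fin 4) F)) (a b : ℝ) :
    ∃ J : HermitianTraceless 4 F ≃ₗᵢ[ℝ] HermitianTraceless 4 F,
      J (unitaryConj P (signPairs F a b)) = -unitaryConj P (signPairs F a b) ∧
      ∀ v w, jordan F (J v) (J w) = J (jordan F v w) := by
  let Q₀ : Matrix (Fin 4) (Fin 4) F := !![0, 1, 0, 0; 1, 0, 0, 0; 0, 0, 0, 1; 0, 0, 1, 0]
  have hstar : star Q₀ = Q₀ := by
    ext i j
    fin_cases i <;> fin_cases j <;> simp [Q₀]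
  have hsq : Q₀ * Q₀ = 1 := by
    ext i j
    fin_cases i <;> fin_cases j <;> simp [Q₀, Matrix.mul_apply, Fin.sum_univ_four]
  let Q : unitary (Matrix (Fin 4) (Fin 4) F) :=
    ⟨Q₀, Unitary.mem_iff.2 ⟨by rw [hstar, hsq], by rw [hstar, hsq]⟩⟩
  have hQ : unitaryConj Q (signPairs F a b) = -signPairs F a b := by
    apply toMat_injective
    rw [toMat_unitaryConj, signPairs, toMat_neg, toMat_diagElt]
    change star Q₀ * _ * Q₀ = _
    have hanti : (realDiagonal ![a, -a, b, -b] : Matrix (Fin 4) (Fin 4) F) * Q₀ =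
        -(Q₀ * realDiagonal ![a, -a, b, -b]) := by
      ext i j
      rw [realDiagonal, Matrix.diagonal_mul, Matrix.neg_apply, Matrix.mul_diagonal]
      fin_cases i <;> fin_cases j <;> simp [Q₀]
    rw [hstar, mul_assoc, hanti, mul_neg, ← mul_assoc, hsq, one_mul]
  refine ⟨((unitaryConj P).symm.trans (unitaryConj Q)).trans (unitaryConj P), ?_, fun v w => ?_⟩
  · simp only [LinearIsometryEquiv.trans_apply, LinearIsometryEquiv.symm_apply_apply, hQ, map_neg]
  · simp only [LinearIsometryEquiv.trans_apply, jordan_unitaryConj, jordan_unitaryConj_symm]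

/-- Multiplication by `diag(a, -a, b, -b)` maps the normal line, spanned by `diag(1, 1, -1, -1)`,
into the plane of the matrices `diag(c, -c, d, -d)`, and this plane into the normal line. -/
theorem exists_jordan_jordan_jordan_eq {A : HermitianTraceless 4 F}
    (hA : A ∈ cubicZeros (jordan F) (smallJordan F)) :
    ∃ β : ℝ, jordan F A (jordan F A (jordan F A A)) = β • jordan F A A := by
  obtain ⟨P, a, b, h, hb, hba, rfl⟩ := exists_eq_unitaryConj_signPairs_pos hA
  refine ⟨1 / 4, ?_⟩
  rw [jordan_unitaryConj, jordan_unitaryConj, jordan_unitaryConj, ← map_smul, jordan_signPairs,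
    jordan_signPairs_blockSigns, jordan_signPairs, smul_blockSigns]
  congr 2
  linear_combination (a ^ 2 - b ^ 2) / 4 * h

end NormalForm

/-! ### Principal curvatures at a normal form -/

section Curvatures

theorem Module.End.finrank_le_finrank_eigenspace {V G : Type*} [AddCommGroup V] [Module ℝ V]
    [FiniteDimensional ℝ V] [AddCommGroup G] [Module ℝ G] {T : Submodule ℝ V}
    (S : Module.End ℝ T) (c : ℝ) (f : G →ₗ[ℝ] V) (hf : Function.Injective f)
    (h : ∀ q, ∃ hq : f q ∈ T, (⟨f q, hq⟩ : T) ∈ S.eigenspace c) :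
    Module.finrank ℝ G ≤ Module.finrank ℝ (S.eigenspace c) := by
  let g : G →ₗ[ℝ] S.eigenspace c :=
    (f.codRestrict T fun q => (h q).1).codRestrict (S.eigenspace c) fun q => (h q).2
  exact LinearMap.finrank_le_finrank_of_injective (f := g) fun q r hqr =>
    hf (congrArg (fun v : S.eigenspace c => ((v : T) : V)) hqr)

variable {F : Type} [NormedRing F] [StarRing F] [InnerProductSpace ℝ F] [IsHurwitz F]
  [StarModule ℝ F]

theorem offDiag_injective (i j : Fin 4) (hij : i ≠ j) :
    Function.Injective (offDiag F i j hij) := by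
  intro q r h
  have h1 := congrArg (fun A => toMat A i j) h
  simp only [toMat_offDiag, Matrix.add_apply, Matrix.single_apply_same,
    Matrix.single_apply_of_row_ne hij.symm, add_zero] at h1
  exact h1

variable (F) in
/-- The tangent directions along which the curvature vanishes at `diag(a, -a, b, -b)`: the
off-diagonal entries which couple opposite eigenvalues, and the diagonal matrices tangent to the
level set. -/
def flatDirections (a b : ℝ) : (F × F) × ℝ →ₗ[ℝ] HermitianTraceless 4 F :=
  ((offDiag F 0 1 (by decide)).coprod (offDiag F 2 3 (by decide))).coprod
    (LinearMap.toSpanSingleton ℝ _ (signPairs F b (-a)))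

theorem flatDirections_apply (a b : ℝ) (q : (F × F) × ℝ) :
    flatDirections F a b q = offDiag F 0 1 (by decide) q.1.1 + offDiag F 2 3 (by decide) q.1.2 +
      q.2 • signPairs F b (-a) := rfl

theorem flatDirections_injective {a b : ℝ} (hb : b ≠ 0) :
    Function.Injective (flatDirections F a b) := by
  rw [injective_iff_map_eq_zero]
  rintro ⟨⟨q, r⟩, t⟩ h
  rw [flatDirections_apply] at h
  have h' : ∀ i j, toMat (offDiag F 0 1 (by decide) q + offDiag F 2 3 (by decide) r +
      t • signPairs F b (-a)) i j = 0 := fun i j =>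
    congrArg (fun A => toMat A i j) h
  have h1 := h' 0 1
  have h2 := h' 2 3
  have h3 := h' 0 0
  simp only [toMat_add, toMat_smul, toMat_offDiag, signPairs, toMat_diagElt,
    realDiagonal] at h1 h2 h3
  have := IsHurwitz.nontrivial F
  have hq : q = 0 := by simpa using h1
  have hr : r = 0 := by simpa using h2
  have ht : t = 0 := by simpa [hb] using h3
  rw [hq, hr, ht]
  rfl

theorem inner_diagElt_flatDirections (c : Fin 4 → ℝ) (hc : ∑ i, c i = 0) (a b : ℝ)
    (q : (F × F) × ℝ) : inner ℝ (diagElt F c hc) (flatDirections F a b q) =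
      q.2 * inner ℝ (diagElt F c hc) (signPairs F b (-a)) := by
  rw [flatDirections_apply, inner_add_right (E := HermitianTraceless 4 F),
    inner_add_right (E := HermitianTraceless 4 F), inner_diagElt_offDiag, inner_diagElt_offDiag,
    real_inner_smul_right (F := HermitianTraceless 4 F), add_zero, zero_add]

variable [FiniteDimensional ℝ F] {ξ : HermitianTraceless 4 F → HermitianTraceless 4 F}

/-- Up to the normal direction the Jordan product with `diag(a, -a, b, -b)` vanishes on the flat
directions. -/
theorem jordan_signPairs_flatDirections {a b : ℝ} (hb : 0 < b) (hba : b < a) (q : (F × F) × ℝ) :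
    jordan F (signPairs F a b) (flatDirections F a b q) =
      (0 : ℝ) • flatDirections F a b q +
        (q.2 * (2 * a * b / (a ^ 2 - b ^ 2))) • jordan F (signPairs F a b) (signPairs F a b) := by
  have hn : a ^ 2 - b ^ 2 ≠ 0 := by nlinarith
  rw [zero_smul, zero_add, flatDirections_apply, map_add, map_add, map_smul, jordan_signPairs,
    jordan_signPairs, smul_blockSigns, smul_blockSigns, signPairs, jordan_diagElt_offDiag,
    jordan_diagElt_offDiag]
  simp
  congr 1
  field_simp
  ring

theorem mem_tangentSpaceOf_unitaryConj_signPairs (P : unitary (Matrix (Fin 4) (Fin 4) F)) {a b : ℝ}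
    (h : a ^ 2 + b ^ 2 = 1 / 2) (hb : 0 < b) (hba : b < a) {v : HermitianTraceless 4 F}
    (h1 : inner ℝ (signPairs F a b) v = 0) (h2 : ∀ r, inner ℝ (blockSigns F r) v = 0) :
    unitaryConj P v ∈ tangentSpaceOf (cubicZeros (jordan F) (smallJordan F))
      (unitaryConj P (signPairs F a b)) := by
  rw [(isCubicProduct_jordan F).mem_tangentSpaceOf (isOpen_smallJordan F)
    (unitaryConj_signPairs_mem P h hb hba), jordan_unitaryConj, inner_unitaryConj,
    inner_unitaryConj, jordan_signPairs]
  exact ⟨h1, h2 _⟩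

/-- The principal curvatures at `P* diag(a, -a, b, -b) P` and their multiplicities: the entries
`(1, 3)`, `(0, 2)`, `(1, 2)`, `(0, 3)` span the first four principal spaces. -/
theorem finrank_eigenspace_unitaryConj_signPairs (P : unitary (Matrix (Fin 4) (Fin 4) F)) {a b : ℝ}
    (hξ : ∀ x ∈ cubicZeros (jordan F) (smallJordan F), ξ x = ‖jordan F x x‖⁻¹ • jordan F x x)
    (h : a ^ 2 + b ^ 2 = 1 / 2) (hb : 0 < b) (hba : b < a) {κ : Fin 5 → ℝ}
    (hκ : κ = ![(a - b)⁻¹, -(a - b)⁻¹, (a + b)⁻¹, -(a + b)⁻¹, 0]) :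
    Function.Injective κ ∧
    (∀ i, Module.finrank ℝ ((shapeOperator (cubicZeros (jordan F) (smallJordan F)) ξ
      (unitaryConj P (signPairs F a b))).eigenspace (κ i)) =
        (![Module.finrank ℝ F, Module.finrank ℝ F, Module.finrank ℝ F, Module.finrank ℝ F,
          2 * Module.finrank ℝ F + 1] : Fin 5 → ℕ) i) ∧
    ∀ c, (shapeOperator (cubicZeros (jordan F) (smallJordan F)) ξ
      (unitaryConj P (signPairs F a b))).HasEigenvalue c ↔ ∃ i, c = κ i := by
  have hmem := unitaryConj_signPairs_mem P h hb hba
  have hB := isCubicProduct_jordan F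
  have hU := isOpen_smallJordan F
  have hm := IsHurwitz.finrank_pos F
  have hab : 0 < a - b := sub_pos.2 hba
  have hab' : 0 < a + b := by linarith
  have hlt : (a + b)⁻¹ < (a - b)⁻¹ := inv_strictAnti₀ hab (by linarith)
  have hpos : 0 < (a + b)⁻¹ := inv_pos.2 hab'
  have hinj : Function.Injective κ := by
    subst hκ
    intro i j hij
    fin_cases i <;> fin_cases j <;> simp at hij ⊢ <;> linarith
  have hnorm := norm_jordan_unitaryConj_signPairs P hb.le hba.le
  set S := shapeOperator (cubicZeros (jordan F) (smallJordan F)) ξ (unitaryConj P (signPairs F a b))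
  have hfac : a ^ 2 - b ^ 2 = (a - b) * (a + b) := by ring
  have hoff : ∀ (i j : Fin 4) (hij : i ≠ j) (c : ℝ),
      -((![a, -a, b, -b] : Fin 4 → ℝ) i + (![a, -a, b, -b] : Fin 4 → ℝ) j) = c * (a ^ 2 - b ^ 2) →
      Module.finrank ℝ F ≤ Module.finrank ℝ (S.eigenspace c) := by
    intro i j hij c hc
    refine Module.End.finrank_le_finrank_eigenspace S c
      ((unitaryConj P).toLinearEquiv.toLinearMap ∘ₗ offDiag F i j hij)
      ((unitaryConj P).injective.comp (offDiag_injective i j hij)) fun q => ?_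
    have hq := mem_tangentSpaceOf_unitaryConj_signPairs P h hb hba
      (v := offDiag F i j hij q) (inner_diagElt_offDiag _ _ _ _ _ _)
      fun r => inner_diagElt_offDiag _ _ _ _ _ _
    refine ⟨hq, ?_⟩
    have key := hB.mem_eigenspace_shapeOperator hU hξ hmem hq
      (μ := ((![a, -a, b, -b] : Fin 4 → ℝ) i + (![a, -a, b, -b] : Fin 4 → ℝ) j) / 2) (β := 0) (by
        rw [jordan_unitaryConj, signPairs, jordan_diagElt_offDiag, map_smul, zero_smul, add_zero])
    rw [hnorm] at key
    have hn : a ^ 2 - b ^ 2 ≠ 0 := by rw [hfac]; positivity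
    convert! key using 2
    rw [eq_comm, ← mul_right_cancel_iff_of_pos (lt_of_le_of_ne (by rw [hfac]; positivity) hn.symm),
      ← hc]
    field_simp
  -- the Jordan product with the normal form maps the flat directions to normal vectors
  have hflat : 2 * Module.finrank ℝ F + 1 ≤ Module.finrank ℝ (S.eigenspace 0) := by
    have e : Module.finrank ℝ ((F × F) × ℝ) = 2 * Module.finrank ℝ F + 1 := by
      simp; ring
    rw [← e]
    refine Module.End.finrank_le_finrank_eigenspace S 0
      ((unitaryConj P).toLinearEquiv.toLinearMap ∘ₗ flatDirections F a b)
      ((unitaryConj P).injective.comp (flatDirections_injective hb.ne')) fun q => ?_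
    have hq := mem_tangentSpaceOf_unitaryConj_signPairs P h hb hba (v := flatDirections F a b q)
      (by
        rw [signPairs, inner_diagElt_flatDirections, ← signPairs, inner_signPairs]
        ring)
      (fun r => by
        rw [blockSigns, inner_diagElt_flatDirections, ← blockSigns,
          real_inner_comm (F := HermitianTraceless 4 F), inner_signPairs_blockSigns, mul_zero])
    refine ⟨hq, ?_⟩
    have key := hB.mem_eigenspace_shapeOperator hU hξ hmem hq
      (μ := 0) (β := q.2 * (2 * a * b / (a ^ 2 - b ^ 2))) (by
        rw [jordan_unitaryConj, jordan_unitaryConj, jordan_signPairs_flatDirections hb hba, map_add,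
          map_smul, map_smul])
    rwa [mul_zero] at key
  refine ⟨hinj, Module.End.finrank_eigenspace_of_sum_le S hinj ?_ ?_ ?_⟩
  · rw [hB.finrank_tangentSpaceOf hU (d := 6 * Module.finrank ℝ F + 1)
      finrank_hermitianTraceless hmem]
    simp [Fin.sum_univ_five]
    linarith
  · subst hκ
    intro i
    fin_cases i
    · exact hoff 1 3 (by decide) _ (by simp [hfac]; field_simp; ring)
    · exact hoff 0 2 (by decide) _ (by simp [hfac]; field_simp; ring)
    · exact hoff 1 2 (by decide) _ (by simp [hfac]; field_simp; ring)
    · exact hoff 0 3 (by decide) _ (by simp [hfac]; field_simp; ring)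
    · exact hflat
  · intro i
    fin_cases i <;> simp [hm]

end Curvatures

/-! ### Connectedness of the set of orthonormal triples -/

section Frames

theorem hermForm_eq_zero_comm {F : Type} [NormedRing F] [StarRing F] {n : ℕ}
    {v w : PiLp 2 (fun _ : Fin n => F)} (h : hermForm v w = 0) : hermForm w v = 0 := by
  rw [← star_hermForm, h, star_zero]

variable {F : Type} [NormedRing F] [StarRing F] [InnerProductSpace ℝ F] [IsHurwitz F] {n k : ℕ}

theorem IsFrame.norm_eq_one {s : Fin k → PiLp 2 (fun _ : Fin n => F)} (hs : IsFrame s) (i : Fin k) :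
    ‖s i‖ = 1 := by
  have h := hs i i
  rw [if_pos rfl] at h
  have h1 := inner_one_hermForm (s i) (s i)
  rw [h, IsHurwitz.inner_one_one, real_inner_self_eq_norm_sq] at h1
  nlinarith [norm_nonneg (s i)]

theorem hermForm_self_of_norm_eq_one {v : PiLp 2 (fun _ : Fin n => F)} (hv : ‖v‖ = 1) :
    hermForm v v = 1 := by
  rw [hermForm_self, hv, one_pow, one_smul]

theorem IsFrame.update {s : Fin k → PiLp 2 (fun _ : Fin n => F)} (hs : IsFrame s) (i : Fin k)
    {w : PiLp 2 (fun _ : Fin n => F)} (hw : ‖w‖ = 1) (h : ∀ j, j ≠ i → hermForm (s j) w = 0) :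
    IsFrame (Function.update s i w) := by
  intro j l
  by_cases hj : j = i <;> by_cases hl : l = i
  · rw [hj, hl, Function.update_self, if_pos rfl, hermForm_self_of_norm_eq_one hw]
  · rw [hj, Function.update_self, Function.update_of_ne hl, if_neg (Ne.symm hl),
      hermForm_eq_zero_comm (h l hl)]
  · rw [hl, Function.update_self, Function.update_of_ne hj, if_neg hj, h j hj]
  · rw [Function.update_of_ne hj, Function.update_of_ne hl, hs]

theorem isFrame_triple {u v w : PiLp 2 (fun _ : Fin n => F)} (hu : ‖u‖ = 1) (hv : ‖v‖ = 1)
    (hw : ‖w‖ = 1) (huv : hermForm u v = 0) (huw : hermForm u w = 0) (hvw : hermForm v w = 0) :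
    IsFrame ![u, v, w] := by
  intro i j
  fin_cases i <;> fin_cases j <;>
    simp [hermForm_self_of_norm_eq_one, hermForm_eq_zero_comm, *]

variable [FiniteDimensional ℝ F]

/-- Two frames which differ in one vector only can be joined by moving this vector in the unit
sphere of the orthogonal complement of the others, which has real dimension at least two. -/
theorem IsFrame.joinedIn_of_eq {s t : Fin (k + 1) → PiLp 2 (fun _ : Fin n => F)} (hs : IsFrame s)
    (ht : IsFrame t) (i : Fin (k + 1)) (h : ∀ j, j ≠ i → s j = t j) (hk : k + 2 ≤ n) :
    JoinedIn {s : Fin (k + 1) → PiLp 2 (fun _ : Fin n => F) | IsFrame s} s t := by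
  let W := hermPerp fun j : Fin k => s (i.succAbove j)
  have hW : ∀ w : PiLp 2 (fun _ : Fin n => F), w ∈ W ↔ ∀ j, j ≠ i → hermForm (s j) w = 0 := by
    intro w
    rw [mem_hermPerp]
    constructor
    · intro hw j hj
      obtain ⟨l, rfl⟩ := Fin.exists_succAbove_eq hj
      exact hw l
    · exact fun hw j => hw _ (Fin.succAbove_ne i j)
  have hrank : 1 < Module.rank ℝ W := by
    have h1 := le_finrank_hermPerp fun j : Fin k => s (i.succAbove j)
    have h2 := IsHurwitz.finrank_pos F
    have h3 : 1 < Module.finrank ℝ W := by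
      have h4 : (k + 2) * Module.finrank ℝ F ≤ n * Module.finrank ℝ F := Nat.mul_le_mul_right _ hk
      change _ ≤ _ + Module.finrank ℝ W at h1
      nlinarith
    exact Module.lt_rank_of_lt_finrank (by exact_mod_cast h3)
  have hcont : Continuous fun z : W => Function.update s i (z : PiLp 2 (fun _ : Fin n => F)) :=
    continuous_const.update i continuous_subtype_val
  have hs' : s i ∈ W := (hW _).2 fun j hj => by rw [hs j i, if_neg hj]
  have ht' : t i ∈ W := (hW _).2 fun j hj => by rw [h j hj, ht j i, if_neg hj]
  have hpath := (isPathConnected_sphere hrank (0 : W) zero_le_one).image hcont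
  refine (hpath.joinedIn s ⟨⟨s i, hs'⟩, ?_, ?_⟩ t ⟨⟨t i, ht'⟩, ?_, ?_⟩).mono ?_
  · rw [mem_sphere_zero_iff_norm]
    exact hs.norm_eq_one i
  · exact Function.update_eq_self i s
  · rw [mem_sphere_zero_iff_norm]
    exact ht.norm_eq_one i
  · ext1 j
    change Function.update s i (t i) j = t j
    by_cases hj : j = i
    · rw [hj, Function.update_self]
    · rw [Function.update_of_ne hj, h j hj]
  · rintro _ ⟨z, hz, rfl⟩
    rw [mem_sphere_zero_iff_norm] at hz
    exact hs.update i hz ((hW _).1 z.2)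

/-- Frames of three vectors in a space of dimension four with a common first vector can be joined:
an auxiliary vector orthogonal to the first and to both second vectors serves as third vector while
the second one moves. -/
theorem IsFrame.joinedIn_of_fst_eq {u v₁ v₂ w₁ w₂ : PiLp 2 (fun _ : Fin 4 => F)}
    (hs : IsFrame ![u, v₁, v₂]) (ht : IsFrame ![u, w₁, w₂]) :
    JoinedIn {s : Fin 3 → PiLp 2 (fun _ : Fin 4 => F) | IsFrame s} ![u, v₁, v₂] ![u, w₁, w₂] := by
  obtain ⟨z, hz, hz1⟩ := exists_unit_mem_hermPerp ![u, v₁, w₁] (by norm_num)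
  rw [mem_hermPerp] at hz
  have h1 : IsFrame ![u, v₁, z] :=
    isFrame_triple (hs.norm_eq_one 0) (hs.norm_eq_one 1) hz1 (hs 0 1) (hz 0) (hz 1)
  have h2 : IsFrame ![u, w₁, z] :=
    isFrame_triple (hs.norm_eq_one 0) (ht.norm_eq_one 1) hz1 (ht 0 1) (hz 0) (hz 2)
  have e1 := hs.joinedIn_of_eq h1 2 (by
    intro j hj
    fin_cases j
    exacts [rfl, rfl, absurd rfl hj]) le_rfl
  have e2 := h1.joinedIn_of_eq h2 1 (by
    intro j hj
    fin_cases j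
    exacts [rfl, absurd rfl hj, rfl]) le_rfl
  have e3 := h2.joinedIn_of_eq ht 2 (by
    intro j hj
    fin_cases j
    exacts [rfl, rfl, absurd rfl hj]) le_rfl
  exact (e1.trans e2).trans e3

/-- With two auxiliary vectors orthogonal to both first vectors, the first vector of a triple can be
moved to that of another one. -/
theorem isPreconnected_frames :
    IsPreconnected {s : Fin 3 → PiLp 2 (fun _ : Fin 4 => F) | IsFrame s} := by
  refine isPreconnected_of_forall_pair fun s hs t ht => ?_
  have hj : JoinedIn {s : Fin 3 → PiLp 2 (fun _ : Fin 4 => F) | IsFrame s} s t := by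
    have es : s = ![s 0, s 1, s 2] := by ext1 j; fin_cases j <;> rfl
    have et : t = ![t 0, t 1, t 2] := by ext1 j; fin_cases j <;> rfl
    rw [es] at hs ⊢
    rw [et] at ht ⊢
    obtain ⟨y, hy, hy1⟩ := exists_unit_mem_hermPerp ![s 0, t 0] (by norm_num)
    obtain ⟨z, hz, hz1⟩ := exists_unit_mem_hermPerp ![s 0, t 0, y] (by norm_num)
    rw [mem_hermPerp] at hy hz
    have h1 : IsFrame ![s 0, y, z] :=
      isFrame_triple (hs.norm_eq_one 0) hy1 hz1 (hy 0) (hz 0) (hz 2)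
    have h2 : IsFrame ![t 0, y, z] :=
      isFrame_triple (ht.norm_eq_one 0) hy1 hz1 (hy 1) (hz 1) (hz 2)
    have e := h1.joinedIn_of_eq h2 0 (by
      intro j hj
      fin_cases j
      exacts [absurd rfl hj, rfl, rfl]) le_rfl
    exact ((hs.joinedIn_of_fst_eq h1).trans e).trans (h2.joinedIn_of_fst_eq ht)
  obtain ⟨γ, hγ⟩ := hj
  exact ⟨Set.range γ, Set.range_subset_iff.2 hγ, ⟨0, γ.source⟩, ⟨1, γ.target⟩,
    isPreconnected_range γ.continuous⟩

end Frames

/-! ### Connectedness and noncompactness of the hypersurface -/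

section Connected

theorem exists_frame_eq {F : Type} [NormedRing F] [StarRing F]
    (P : unitary (Matrix (Fin 4) (Fin 4) F)) :
    ∃ s : Fin 4 → PiLp 2 (fun _ : Fin 4 => F), IsFrame s ∧
      frameMatrix s = star (P : Matrix (Fin 4) (Fin 4) F) := by
  refine ⟨fun k => WithLp.toLp 2 fun i => star (P : Matrix (Fin 4) (Fin 4) F) i k, ?_, rfl⟩
  intro i j
  have h : ((P : Matrix (Fin 4) (Fin 4) F) * star (P : Matrix (Fin 4) (Fin 4) F)) i j =
      (1 : Matrix (Fin 4) (Fin 4) F) i j := by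
    rw [Unitary.mul_star_self_of_mem P.2]
  rw [Matrix.mul_apply, Matrix.one_apply] at h
  rw [← h]
  simp [hermForm]

variable {F : Type} [NormedRing F] [StarRing F] [InnerProductSpace ℝ F] [IsHurwitz F]

/-- The matrix with orthonormal eigenvectors `s 0`, `s 1`, `s 2` for the eigenvalues `a`, `-a`,
`b` and with eigenvalue `-b` on their orthogonal complement, as a family of entries. -/
def frameEntries (s : Fin 3 → PiLp 2 (fun _ : Fin 4 => F)) (a b : ℝ) :
    PiLp 2 (fun _ : Fin 4 × Fin 4 => F) :=
  WithLp.toLp 2 fun p =>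
    a • (s 0 p.1 * star (s 0 p.2) - s 1 p.1 * star (s 1 p.2)) +
    b • (s 0 p.1 * star (s 0 p.2) + s 1 p.1 * star (s 1 p.2) +
      (2 : ℝ) • (s 2 p.1 * star (s 2 p.2)) - if p.1 = p.2 then 1 else 0)

/-- As the eigenvectors form an orthonormal basis, the projection to the last one is the identity
minus the projections to the others. -/
theorem frameEntries_init [FiniteDimensional ℝ F] {s : Fin 4 → PiLp 2 (fun _ : Fin 4 => F)}
    (hs : IsFrame s) (a b : ℝ) : entriesToMatrix (frameEntries (fun i => s i.castSucc) a b) =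
      frameMatrix s * realDiagonal ![a, -a, b, -b] * star (frameMatrix s) := by
  have h := Unitary.mul_star_self_of_mem hs.frameMatrix_mem_unitary
  ext i j
  have h' := congrFun (congrFun h i) j
  rw [Matrix.mul_apply, Matrix.one_apply, Fin.sum_univ_four] at h'
  change frameEntries (fun k => s k.castSucc) a b (i, j) = _
  rw [Matrix.mul_apply, Fin.sum_univ_four]
  dsimp only [frameEntries]
  rw [← h']
  simp only [realDiagonal, Matrix.mul_diagonal, mul_smul_comm, smul_mul_assoc, mul_one]
  simp [frameMatrix]
  module

theorem continuous_frameEntries : Continuous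
    fun p : (Fin 3 → PiLp 2 (fun _ : Fin 4 => F)) × ℝ =>
      frameEntries p.1 p.2 √(1 / 2 - p.2 ^ 2) := by
  have : ContinuousStar F :=
    ⟨(AddMonoidHomClass.isometry_of_norm (starAddEquiv : F ≃+ F) IsHurwitz.norm_star).continuous⟩
  unfold frameEntries
  fun_prop

variable [FiniteDimensional ℝ F] [StarModule ℝ F]

/-- The invertible regular zeros are parametrized by orthonormal triples and the largest eigenvalue
`a`, which lies between `1 / 2` and `√(1 / 2)` since `a ^ 2 + b ^ 2 = 1 / 2` and `0 < b < a`. -/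
theorem image_coe_cubicZeros_jordan :
    (Subtype.val : HermitianTraceless 4 F → _) '' cubicZeros (jordan F) (smallJordan F) =
      (fun p : (Fin 3 → PiLp 2 (fun _ : Fin 4 => F)) × ℝ =>
        frameEntries p.1 p.2 √(1 / 2 - p.2 ^ 2)) ''
      ({s | IsFrame s} ×ˢ Set.Ioo (1 / 2) √(1 / 2)) := by
  have key : ∀ {s : Fin 4 → PiLp 2 (fun _ : Fin 4 => F)} (hs : IsFrame s)
      (P : unitary (Matrix (Fin 4) (Fin 4) F))
      (hP : frameMatrix s = star (P : Matrix (Fin 4) (Fin 4) F)) (a b : ℝ),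
      frameEntries (fun i => s i.castSucc) a b =
        (unitaryConj P (signPairs F a b) : PiLp 2 (fun _ : Fin 4 × Fin 4 => F)) := by
    intro s hs P hP a b
    have h := frameEntries_init hs a b
    rw [hP, star_star] at h
    ext p
    exact congrFun (congrFun h p.1) p.2
  ext x
  constructor
  · rintro ⟨A, hA, rfl⟩
    obtain ⟨P, a, b, h, hb, hba, rfl⟩ := exists_eq_unitaryConj_signPairs_pos hA
    obtain ⟨s, hs, hP⟩ := exists_frame_eq P
    refine ⟨(fun i => s i.castSucc, a), ⟨fun i j => ?_, ?_, ?_⟩, ?_⟩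
    · simp [hs i.castSucc j.castSucc]
    · nlinarith
    · exact Real.lt_sqrt_of_sq_lt (by nlinarith)
    · have hab : 1 / 2 - a ^ 2 = b ^ 2 := by linarith
      dsimp only
      rw [hab, Real.sqrt_sq hb.le, key hs P hP]
  · rintro ⟨⟨s, a⟩, ⟨hs, ha, ha'⟩, rfl⟩
    dsimp only at hs ha ha' ⊢
    obtain ⟨w, hw, hw1⟩ := exists_unit_mem_hermPerp s (by norm_num)
    have ht := hs.snoc (hermForm_self_of_norm_eq_one hw1) (mem_hermPerp.1 hw)
    have hsq : a ^ 2 < 1 / 2 := by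
      rwa [Real.lt_sqrt (by linarith)] at ha'
    have e : s = fun i => (Fin.snoc s w : Fin 4 → PiLp 2 (fun _ : Fin 4 => F)) i.castSucc := by
      ext1 i
      rw [Fin.snoc_castSucc]
    let P : unitary (Matrix (Fin 4) (Fin 4) F) := star ⟨_, ht.frameMatrix_mem_unitary⟩
    refine ⟨unitaryConj P (signPairs F a √(1 / 2 - a ^ 2)),
      unitaryConj_signPairs_mem P ?_ ?_ ?_, ?_⟩
    · rw [Real.sq_sqrt (by linarith)]
      ring
    · exact Real.sqrt_pos.2 (by linarith)
    · rw [Real.sqrt_lt' (by linarith)]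
      nlinarith
    · rw [← key ht P (by rw [coe_star_unitary, star_star]), ← e]

theorem isConnected_cubicZeros_jordan :
    IsConnected (cubicZeros (jordan F) (smallJordan F)) := by
  constructor
  · refine ⟨_, unitaryConj_signPairs_mem 1 (a := √(3 / 8)) (b := √(1 / 8)) ?_ ?_ ?_⟩
    · rw [Real.sq_sqrt (by norm_num), Real.sq_sqrt (by norm_num)]
      norm_num
    · positivity
    · exact Real.sqrt_lt_sqrt (by norm_num) (by norm_num)
  · rw [← Topology.IsInducing.subtypeVal.isPreconnected_image, image_coe_cubicZeros_jordan]
    exact (isPreconnected_frames.prod isPreconnected_Ioo).image _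
      continuous_frameEntries.continuousOn

theorem not_isCompact_cubicZeros_jordan :
    ¬ IsCompact (cubicZeros (jordan F) (smallJordan F)) := by
  intro hc
  obtain ⟨A, hA, hmax⟩ := hc.exists_isMaxOn (isConnected_cubicZeros_jordan (F := F)).nonempty
    (continuous_norm_jordan_self F).continuousOn
  have hA1 : ‖jordan F A A‖ < 1 / 2 := hA.1
  -- a larger value below `1 / 2` is attained at a diagonal matrix
  obtain ⟨s, hs, hs'⟩ := exists_between hA1
  have hs0 : 0 < s := (norm_nonneg _).trans_lt hs
  have h1 : 0 < 1 / 4 - s / 2 := by linarith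
  have hlt : √(1 / 4 - s / 2) < √(1 / 4 + s / 2) := Real.sqrt_lt_sqrt h1.le (by linarith)
  have hmem := unitaryConj_signPairs_mem (F := F) 1 (a := √(1 / 4 + s / 2))
    (b := √(1 / 4 - s / 2)) (by
      rw [Real.sq_sqrt (by linarith), Real.sq_sqrt h1.le]
      ring) (Real.sqrt_pos.2 h1) hlt
  have h2 := hmax hmem
  dsimp only [Set.mem_ofPred_eq] at h2
  rw [norm_jordan_unitaryConj_signPairs _ (Real.sqrt_nonneg _) hlt.le,
    Real.sq_sqrt (by linarith), Real.sq_sqrt h1.le] at h2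
  linarith

end Connected

/-! ### Dupin property -/

section ProperDupin

variable {F : Type} [NormedRing F] [StarRing F] [InnerProductSpace ℝ F] [IsHurwitz F]
  [StarModule ℝ F] [FiniteDimensional ℝ F]

/-- The nonzero principal curvatures `±1 / (a - b)` and `±1 / (a + b)` have absolute value at least
`1` since `(a + b) ^ 2 ≤ 2 (a ^ 2 + b ^ 2) = 1`, and `a`, `b` are functions of
`a ^ 2 - b ^ 2`, which is the norm of `jordan F x x`. -/
theorem isProperDupin_cubicZeros_jordan {ξ : HermitianTraceless 4 F → HermitianTraceless 4 F}
    (hξ : ∀ x ∈ cubicZeros (jordan F) (smallJordan F), ξ x = ‖jordan F x x‖⁻¹ • jordan F x x) :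
    IsProperDupin (cubicZeros (jordan F) (smallJordan F)) ξ := by
  refine ⟨(isCubicProduct_jordan F).isDupin (isOpen_smallJordan F) hξ
    (fun x hx => exists_jordan_jordan_jordan_eq hx) one_pos ?_
    -- `1 / 4 + s / 2` and `1 / 4 - s / 2` are the squares of the eigenvalues if the norm is `s`
    (Λ := fun s => Set.range (![(√(1 / 4 + s / 2) - √(1 / 4 - s / 2))⁻¹,
      -(√(1 / 4 + s / 2) - √(1 / 4 - s / 2))⁻¹, (√(1 / 4 + s / 2) + √(1 / 4 - s / 2))⁻¹,
      -(√(1 / 4 + s / 2) + √(1 / 4 - s / 2))⁻¹, 0] : Fin 5 → ℝ))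
    (fun s => Set.finite_range _) ?_, 5, ?_⟩
  · intro x hx κ hκ hκ0
    obtain ⟨P, a, b, h, hb, hba, rfl⟩ := exists_eq_unitaryConj_signPairs_pos hx
    obtain ⟨i, rfl⟩ :=
      ((finrank_eigenspace_unitaryConj_signPairs P hξ h hb hba rfl).2.2 κ).1 hκ
    have h1 : 1 ≤ (a + b)⁻¹ := (one_le_inv₀ (by linarith)).2 (by nlinarith [sq_nonneg (a - b)])
    have h2 : 1 ≤ (a - b)⁻¹ := (one_le_inv₀ (by linarith)).2 (by nlinarith [sq_nonneg (a + b)])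
    have h3 : 0 < (a + b)⁻¹ := by linarith
    have h4 : 0 < (a - b)⁻¹ := by linarith
    fin_cases i
    · exact h2.trans (le_abs_self _)
    · exact h2.trans_eq ((abs_of_pos h4).symm.trans (abs_neg _).symm)
    · exact h1.trans (le_abs_self _)
    · exact h1.trans_eq ((abs_of_pos h3).symm.trans (abs_neg _).symm)
    · exact absurd rfl hκ0
  · intro x hx κ hκ
    obtain ⟨P, a, b, h, hb, hba, rfl⟩ := exists_eq_unitaryConj_signPairs_pos hx
    obtain ⟨i, rfl⟩ :=
      ((finrank_eigenspace_unitaryConj_signPairs P hξ h hb hba rfl).2.2 κ).1 hκ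
    have ha : √(1 / 4 + (a ^ 2 - b ^ 2) / 2) = a := by
      rw [show 1 / 4 + (a ^ 2 - b ^ 2) / 2 = a ^ 2 by linarith, Real.sqrt_sq (hb.trans hba).le]
    have hb' : √(1 / 4 - (a ^ 2 - b ^ 2) / 2) = b := by
      rw [show 1 / 4 - (a ^ 2 - b ^ 2) / 2 = b ^ 2 by linarith, Real.sqrt_sq hb.le]
    rw [norm_jordan_unitaryConj_signPairs P hb.le hba.le]
    rw [ha, hb']
    exact Set.mem_range_self i
  · intro x hx
    obtain ⟨P, a, b, h, hb, hba, rfl⟩ := exists_eq_unitaryConj_signPairs_pos hx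
    obtain ⟨hinj, -, hev⟩ := finrank_eigenspace_unitaryConj_signPairs P hξ h hb hba rfl
    have e : {κ : ℝ | (shapeOperator (cubicZeros (jordan F) (smallJordan F)) ξ
        (unitaryConj P (signPairs F a b))).HasEigenvalue κ} = Set.range
          (![(a - b)⁻¹, -(a - b)⁻¹, (a + b)⁻¹, -(a + b)⁻¹, 0] : Fin 5 → ℝ) := by
      ext κ
      rw [Set.mem_ofPred_eq, hev κ, Set.mem_range]
      simp only [eq_comm]
    rw [e, Set.ncard_range_of_injective hinj]
    simp

end ProperDupin

end

theorem mainTheorem2 (F : Type) [NormedRing F] [StarRing F] [InnerProductSpace ℝ F]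
    [StarModule ℝ F] [FiniteDimensional ℝ F] (hF : IsRealComplexOrQuaternion F)
    (m : ℕ) (hm : m = Module.finrank ℝ F) :
    (∃ U : Set (HermitianTraceless 4 F), IsOpen U ∧
      invertibleRegularZeros 4 F = regularZeros 4 F ∩ U) ∧
    IsSphereHypersurface (6 * m + 1) (invertibleRegularZeros 4 F) ∧
    IsOrientableSubmanifold (6 * m + 1) (invertibleRegularZeros 4 F) ∧
    IsConnected (invertibleRegularZeros 4 F) ∧
    ¬ IsCompact (invertibleRegularZeros 4 F) ∧
    IsAustere (invertibleRegularZeros 4 F) ∧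
    IsUnitNormalField (invertibleRegularZeros 4 F) (unitGrad F) ∧
    IsProperDupin (invertibleRegularZeros 4 F) (unitGrad F) ∧
    ∀ A ∈ invertibleRegularZeros 4 F, ∃ l₁ l₂ : ℝ, 0 < l₂ ∧ l₂ < l₁ ∧
      (∃ P ∈ unitary (Matrix (Fin 4) (Fin 4) F),
        toMat A = star P * Matrix.diagonal
          (fun i => (![l₁, -l₁, l₂, -l₂] : Fin 4 → ℝ) i • (1 : F)) * P) ∧
      0 < gradLength F A ∧
      ∃ κ : Fin 5 → ℝ,
        κ = ![3 * (l₁ + l₂) / gradLength F A, -(3 * (l₁ + l₂) / gradLength F A),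
              3 * (l₁ - l₂) / gradLength F A, -(3 * (l₁ - l₂) / gradLength F A), 0] ∧
        Function.Injective κ ∧
        (∀ c : ℝ, (shapeOperator (invertibleRegularZeros 4 F) (unitGrad F) A).HasEigenvalue c ↔
          ∃ i, c = κ i) ∧
        ∀ i, Module.finrank ℝ
            ((shapeOperator (invertibleRegularZeros 4 F) (unitGrad F) A).eigenspace (κ i)) =
          (![m, m, m, m, 2 * m + 1] : Fin 5 → ℕ) i := by
  have := hF.isHurwitz
  subst hm
  have hB := isCubicProduct_jordan F
  have hU := isOpen_smallJordan F
  have hd : Module.finrank ℝ (HermitianTraceless 4 F) = (6 * Module.finrank ℝ F + 1) + 2 :=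
    finrank_hermitianTraceless
  have hξ : ∀ x ∈ cubicZeros (jordan F) (smallJordan F),
      unitGrad F x = ‖jordan F x x‖⁻¹ • jordan F x x := fun x hx => unitGrad_eq hx
  rw [invertibleRegularZeros_eq]
  refine ⟨⟨smallJordan F, hU, ?_⟩, ⟨hd, fun A hA => ?_, hB.isEmbeddedSubmanifold hU hd⟩,
    hB.isOrientableSubmanifold hU (Nat.succ_pos _) hd, isConnected_cubicZeros_jordan,
    not_isCompact_cubicZeros_jordan, hB.isAustere hU fun A hA => ?_, hB.isUnitNormalField hU hξ,
    isProperDupin_cubicZeros_jordan hξ, fun A hA => ?_⟩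
  · rw [regularZeros_eq]
    ext A
    exact ⟨fun hA => ⟨⟨trivial, hA.2⟩, hA.1⟩, fun hA => ⟨hA.2, hA.1.2⟩⟩
  · rw [mem_sphere_zero_iff_norm]
    exact hA.2.1
  · obtain ⟨P, a, b, -, -, -, rfl⟩ := exists_eq_unitaryConj_signPairs_pos hA
    exact exists_isometry_neg P a b
  · have hgrad := gradLength_eq hA.2.2.1
    obtain ⟨P, a, b, h, hb, hba, rfl⟩ := exists_eq_unitaryConj_signPairs_pos hA
    rw [norm_jordan_unitaryConj_signPairs P hb.le hba.le] at hgrad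
    have h1 : 0 < a - b := sub_pos.2 hba
    have h2 : 0 < a + b := by linarith
    have hfac : a ^ 2 - b ^ 2 = (a - b) * (a + b) := by ring
    have e1 : 3 * (a + b) / (3 * (a ^ 2 - b ^ 2)) = (a - b)⁻¹ := by
      rw [hfac]
      field_simp
    have e2 : 3 * (a - b) / (3 * (a ^ 2 - b ^ 2)) = (a + b)⁻¹ := by
      rw [hfac]
      field_simp
    obtain ⟨hinj, hdim, hev⟩ := finrank_eigenspace_unitaryConj_signPairs P hξ h hb hba rfl
    refine ⟨a, b, hb, hba, ⟨P, P.2, rfl⟩, ?_, _, rfl, ?_⟩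
    · rw [hgrad, hfac]
      positivity
    · rw [hgrad, e1, e2]
      exact ⟨hinj, hev, hdim⟩
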